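/- **2-complexes.** A 2-complex $Y=(V,E,F)$ consists of vertices, oriented edges and oriented faces. Each edge $e$ has a start, an end and an inverse edge $e^{-1}\neq e$; each face $f$ has an inverse face $f^{-1}$ and a boundary $\partial f$, which is a nonempty cyclically reduced edge loop with a starting point, and $\partial(f^{-1})=(\partial f)^{-1}$. Geometric edges (faces) are pairs of inverse edges (faces); $|Y|$ is the number of geometric faces and $\mathrm{Edge}(Y)$ the set of geometric edges. A sub-2-complex $Z\le Y$ is a set of vertices, edges and faces closed under endpoints, inverses and boundaries. **Fillability.** Let $X_m=\{x_1,\dots,x_m\}$ and let $R$ be a set of words in $X_m^{\pm}$. A van Kampen 2-complex of $\langle X_m\mid R\rangle$ with underlying 2-complex $Y$ is a labeling of the edges by $X_m^{\pm}$ and of the faces by $R^{\pm}$, compatible with inverses, such that the label of each face is the word read along its boundary. It is reduced if there are no two different faces $f,f'\in F$ with the same label and with a common edge at the same position of $\partial f$ and $\partial f'$. The 2-complex $Y$ is fillable by $R$ (or by the group presentation $\langle X_m\mid R\rangle$) if it underlies a reduced van Kampen 2-complex of $\langle X_m\mid R\rangle$. **Random groups.** Let $B_\ell$ be the set of cyclically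 reduced words in $X_m^{\pm}$ of length at most $\ell$. A sequence of random groups $(G_\ell(m,d))$ with $m$ generators at density $d\in\{-\infty\}\cup[0,1]$ is given by $G_\ell(m,d)=\langle X_m\mid R_\ell\rangle$, where $R_\ell$ is a random subset of $B_\ell$ whose law is invariant under all permutations of $B_\ell$, and $\log_{|B_\ell|}|R_\ell|$ (with value $-\infty$ when $R_\ell=\emptyset$) converges in probability to $d$ as $\ell\to\infty$. A property of $G_\ell(m,d)$ holds a.a.s. if its probability tends to $1$ as $\ell\to\infty$. **Geometric forms.** A geometric form $(Y,\lambda)$ is a finite connected 2-complex $Y$ with at least one face, in which every edge lies on the boundary of a face, together with lengths $\lambda_e\in(0,1]$ for $e\in\mathrm{Edge}(Y)$ such that every face boundary has total length at most $1$. For $\ell$ large enough that all $\lfloor\lambda_e\ell\rfloor\ge1$, $Y_\ell$ is the 2-complex obtained from $Y$ by dividing every edge $e$ into $\lfloor\lambda_e\ell\rfloor$ edges. For $Z\le Y$ with $|Z|\ge1$ put $$\mathrm{dens}(Z)=\frac{1}{|Z|}\sum_{e\in \mathrm{Edge}(Z)}\lambda_e,\qquad \mathrm{dens}_c(Y)=\min_{Z\le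 Y,\ |Z|\ge 1}\mathrm{dens}(Z).$$ **Theorem.** Let $m\ge2$, let $(G_\ell(m,d))$ be a sequence of random groups with $m$ generators at density $d$, and let $(Y_\ell)$ be the sequence of 2-complexes of a geometric form $(Y,\lambda)$. (i) If $d<1-\mathrm{dens}_c(Y)$, then a.a.s. $Y_\ell$ is not fillable by $G_\ell(m,d)$. (ii) If $d>1-\mathrm{dens}_c(Y)$ and $Y_\ell$ is fillable by $B_\ell$ for all sufficiently large $\ell$, then a.a.s. $Y_\ell$ is fillable by $G_\ell(m,d)$. -/

import Mathlib

open Filter Topology MeasureTheory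

/-! ### Oriented combinatorial 2-complexes -/

/-- An oriented combinatorial 2-complex with vertices `V`, oriented edges `E` and oriented
faces `F`. Edges and faces come with an inverse; the boundary of a face is a nonempty
cyclically reduced loop of edges (a list, so that it has a starting point and a `j`-th edge).
A geometric edge (face) is a pair of inverse edges (faces). -/
structure TwoComplex (V E F : Type*) where
  src : E → V
  tgt : E → V
  inv : E → E
  inv_inv : ∀ e, inv (inv e) = e
  inv_ne : ∀ e, inv e ≠ e
  src_inv : ∀ e, src (inv e) = tgt e
  tgt_inv : ∀ e, tgt (inv e) = src e
  finv : F → F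
  finv_finv : ∀ f, finv (finv f) = f
  bdry : F → List E
  bdry_ne_nil : ∀ f, bdry f ≠ []
  /-- For any two cyclically consecutive edges `a`, `b` of the boundary, `b` starts where `a`
  ends, and `b` is not the inverse of `a`. -/
  bdry_chain : ∀ f, Cycle.Chain (fun a b => tgt a = src b ∧ b ≠ inv a) (bdry f : Cycle E)
  bdry_finv : ∀ f, bdry (finv f) = ((bdry f).map inv).reverse

namespace TwoComplex

variable {V E F : Type*}

/-- Any two vertices are joined by an edge path, and there is a vertex. -/
def Connected (Y : TwoComplex V E F) : Prop :=
  Nonempty V ∧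
    ∀ u v : V, Relation.ReflTransGen (fun a b => ∃ e, Y.src e = a ∧ Y.tgt e = b) u v

/-- Every edge is on the boundary of some face. -/
def NoIsolatedEdges (Y : TwoComplex V E F) : Prop :=
  ∀ e, ∃ f, e ∈ Y.bdry f

/-- A sub-2-complex: sets of vertices, edges, faces closed under endpoints, inverses and
boundaries. -/
@[ext]
structure Sub (Y : TwoComplex V E F) where
  verts : Set V
  edges : Set E
  faces : Set F
  src_mem : ∀ e ∈ edges, Y.src e ∈ verts
  tgt_mem : ∀ e ∈ edges, Y.tgt e ∈ verts
  inv_mem : ∀ e ∈ edges, Y.inv e ∈ edges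
  finv_mem : ∀ f ∈ faces, Y.finv f ∈ faces
  bdry_mem : ∀ f ∈ faces, ∀ e ∈ Y.bdry f, e ∈ edges

/-- The 2-complex itself, as a sub-2-complex. -/
def Sub.top (Y : TwoComplex V E F) : Y.Sub where
  verts := Set.univ
  edges := Set.univ
  faces := Set.univ
  src_mem := fun _ _ => Set.mem_univ _
  tgt_mem := fun _ _ => Set.mem_univ _
  inv_mem := fun _ _ => Set.mem_univ _
  finv_mem := fun _ _ => Set.mem_univ _
  bdry_mem := fun _ _ _ _ => Set.mem_univ _

theorem finv_ne (Y : TwoComplex V E F) (f : F) : Y.finv f ≠ f := by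
  intro h
  have hb := Y.bdry_finv f
  have hc := Y.bdry_chain f
  have hn := Y.bdry_ne_nil f
  rw [h] at hb
  cases hl : Y.bdry f with
  | nil => exact hn hl
  | cons a l =>
    rw [hl] at hb hc
    rw [Cycle.chain_coe_cons] at hc
    rcases List.eq_nil_or_concat l with rfl | ⟨l', b, rfl⟩
    · simp at hb
      exact Y.inv_ne a hb.symm
    · simp at hb
      have h2 : List.IsChain (fun a b => Y.tgt a = Y.src b ∧ b ≠ Y.inv a)
          ((a :: l') ++ [b, a]) := by simpa using hc
      have h3 := h2.right_of_append
      simp only [List.isChain_cons_cons] at h3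
      exact h3.1.2 hb.1

/-! ### Subdivision -/

/-- The point at distance `i` from the start on the arc of `n e` unit edges replacing `e`.
An interior point is the unordered pair of its two descriptions, along `e` and along the
inverse edge. -/
def point (Y : TwoComplex V E F) (n : E → ℕ) (e : E) (i : ℕ) : V ⊕ Sym2 (E × ℕ) :=
  if i = 0 then Sum.inl (Y.src e)
  else if i = n e then Sum.inl (Y.tgt e)
  else Sum.inr s((e, i), (Y.inv e, n e - i))

/-- Vertices of the subdivision: the vertices of `Y` and the interior points of the arcs. -/
def SubdivVert (Y : TwoComplex V E F) (n : E → ℕ) : Type _ :=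
  {x : V ⊕ Sym2 (E × ℕ) // (∃ v, x = Sum.inl v) ∨ ∃ e i, i ≤ n e ∧ x = Y.point n e i}

/-- Oriented edges of the subdivision: `(e, i)` with `i < n e` is the unit edge from the `i`-th
to the `(i+1)`-st point of the arc of `e`. -/
abbrev SubdivEdge (n : E → ℕ) : Type _ := {p : E × ℕ // p.2 < n p.1}

/-- The arc of unit edges replacing `e`. -/
def arc (n : E → ℕ) (e : E) : List (SubdivEdge n) :=
  (List.finRange (n e)).map fun i : Fin (n e) => ⟨(e, i.1), i.2⟩

theorem arc_length (n : E → ℕ) (e : E) : (arc n e).length = n e := by simp [arc]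

theorem arc_getElem? (n : E → ℕ) (e : E) (i : ℕ) (hi : i < n e) :
    (arc n e)[i]? = some ⟨(e, i), hi⟩ := by
  rw [List.getElem?_eq_getElem (by rw [arc_length]; exact hi)]
  simp [arc]

theorem point_inv (Y : TwoComplex V E F) {n : E → ℕ} (hinv : ∀ e, n (Y.inv e) = n e)
    (hn : ∀ e, 0 < n e) (e : E) (i : ℕ) (hi : i ≤ n e) :
    Y.point n (Y.inv e) (n e - i) = Y.point n e i := by
  have := hn e
  unfold point
  rw [hinv, Y.src_inv, Y.tgt_inv, Y.inv_inv]
  by_cases h0 : i = 0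
  · subst h0
    rw [if_neg (by omega), if_pos (by omega), if_pos rfl]
  · by_cases h1 : i = n e
    · rw [if_pos (by omega), if_neg h0, if_pos h1]
    · rw [if_neg (by omega), if_neg (by omega), if_neg h0, if_neg h1]
      have h2 : n e - (n e - i) = i := by omega
      rw [h2, Sym2.eq_swap]

/-- The inverse of the `i`-th unit edge of `e` is the `(n e - 1 - i)`-th unit edge of the
inverse of `e`. -/
def subdivInv (Y : TwoComplex V E F) {n : E → ℕ} (hinv : ∀ e, n (Y.inv e) = n e)
    (p : SubdivEdge n) : SubdivEdge n :=
  ⟨(Y.inv p.1.1, n p.1.1 - 1 - p.1.2), by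
    have := p.2
    rw [hinv]
    show n p.1.1 - 1 - p.1.2 < n p.1.1
    omega⟩

/-- Starting point of a unit edge. -/
def subdivSrc (Y : TwoComplex V E F) (n : E → ℕ) (p : SubdivEdge n) : SubdivVert Y n :=
  ⟨Y.point n p.1.1 p.1.2, Or.inr ⟨_, _, p.2.le, rfl⟩⟩

/-- Ending point of a unit edge. -/
def subdivTgt (Y : TwoComplex V E F) (n : E → ℕ) (p : SubdivEdge n) : SubdivVert Y n :=
  ⟨Y.point n p.1.1 (p.1.2 + 1), Or.inr ⟨_, _, p.2, rfl⟩⟩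

theorem subdiv_isChain (Y : TwoComplex V E F) {n : E → ℕ}
    (hinv : ∀ e, n (Y.inv e) = n e) (hn : ∀ e, 0 < n e) (l : List E)
    (hl : List.IsChain (fun a b => Y.tgt a = Y.src b ∧ b ≠ Y.inv a) l) :
    List.IsChain (fun p q => Y.subdivTgt n p = Y.subdivSrc n q ∧ q ≠ Y.subdivInv hinv p)
      (l.flatMap (arc n)) := by
  have harc : ∀ e, List.IsChain
      (fun p q => Y.subdivTgt n p = Y.subdivSrc n q ∧ q ≠ Y.subdivInv hinv p) (arc n e) := by
    intro e
    rw [List.isChain_iff_getElem]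
    intro i hi
    refine ⟨?_, ?_⟩
    · apply Subtype.ext
      simp [arc, subdivTgt, subdivSrc]
    · intro h
      have h1 := congrArg (fun p => p.1.1) h
      simp [arc, subdivInv] at h1
      exact Y.inv_ne e h1.symm
  induction l with
  | nil => simp
  | cons a l ih =>
    rw [List.flatMap_cons, List.isChain_append]
    refine ⟨harc a, ih hl.tail, ?_⟩
    intro p hp q hq
    cases l with
    | nil => simp at hq
    | cons b l =>
      have hab : Y.tgt a = Y.src b ∧ b ≠ Y.inv a := by
        rw [List.isChain_cons_cons] at hl
        exact hl.1
      have ha := hn a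
      have hb := hn b
      have hp' : p = ⟨(a, n a - 1), by show n a - 1 < n a; omega⟩ := by
        rw [List.getLast?_eq_getElem?, arc_length, arc_getElem? n a (n a - 1) (by omega)] at hp
        exact (Option.some.inj hp).symm
      have hq' : q = ⟨(b, 0), hb⟩ := by
        rw [List.head?_eq_getElem?, List.flatMap_cons,
          List.getElem?_append_left (by rw [arc_length]; exact hb), arc_getElem? n b 0 hb] at hq
        exact (Option.some.inj hq).symm
      rw [hp', hq']
      refine ⟨?_, ?_⟩
      · apply Subtype.ext
        show Y.point n a (n a - 1 + 1) = Y.point n b 0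
        have h1 : n a - 1 + 1 = n a := by omega
        rw [h1]
        simp [point, ha.ne', hab.1]
      · intro h
        exact hab.2 (congrArg (fun p => p.1.1) h)

theorem arc_inv (Y : TwoComplex V E F) {n : E → ℕ} (hinv : ∀ e, n (Y.inv e) = n e) (e : E) :
    arc n (Y.inv e) = ((arc n e).map (Y.subdivInv hinv)).reverse := by
  apply List.ext_getElem
  · simp [arc, hinv]
  · intro i h1 h2
    have h3 : i < n e := by simpa [arc, hinv] using h1
    simp only [arc, List.getElem_map, List.getElem_reverse, subdivInv]
    apply Subtype.ext
    simp
    omega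

/-- The 2-complex obtained from `Y` by dividing every edge `e` into `n e` edges. -/
def subdivide (Y : TwoComplex V E F) (n : E → ℕ) (hinv : ∀ e, n (Y.inv e) = n e)
    (hn : ∀ e, 0 < n e) : TwoComplex (SubdivVert Y n) (SubdivEdge n) F where
  src := Y.subdivSrc n
  tgt := Y.subdivTgt n
  inv := Y.subdivInv hinv
  inv_inv := by
    rintro ⟨⟨e, i⟩, hi⟩
    apply Subtype.ext
    have hi' : i < n e := hi
    show (Y.inv (Y.inv e), n (Y.inv e) - 1 - (n e - 1 - i)) = (e, i)
    rw [Y.inv_inv, hinv]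
    congr 1
    omega
  inv_ne := fun p h => Y.inv_ne p.1.1 (congrArg (fun p => p.1.1) h)
  src_inv := by
    rintro ⟨⟨e, i⟩, hi⟩
    have hi' : i < n e := hi
    apply Subtype.ext
    show Y.point n (Y.inv e) (n e - 1 - i) = Y.point n e (i + 1)
    rw [← Y.point_inv hinv hn e (i + 1) hi']
    congr 1
    omega
  tgt_inv := by
    rintro ⟨⟨e, i⟩, hi⟩
    have hi' : i < n e := hi
    apply Subtype.ext
    show Y.point n (Y.inv e) (n e - 1 - i + 1) = Y.point n e i
    rw [← Y.point_inv hinv hn e i hi'.le]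
    congr 1
    omega
  finv := Y.finv
  finv_finv := Y.finv_finv
  bdry := fun f => (Y.bdry f).flatMap (arc n)
  bdry_ne_nil := by
    intro f h
    rw [List.flatMap_eq_nil_iff] at h
    obtain ⟨a, ha⟩ := List.exists_mem_of_ne_nil _ (Y.bdry_ne_nil f)
    have h1 := congrArg List.length (h a ha)
    have h2 := hn a
    simp [arc] at h1
    omega
  bdry_chain := by
    intro f
    have hc := Y.bdry_chain f
    have hne := Y.bdry_ne_nil f
    cases hl : Y.bdry f with
    | nil => exact absurd hl hne
    | cons a l =>
      rw [hl, Cycle.chain_coe_cons] at hc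
      have h1 := Y.subdiv_isChain hinv hn _ hc
      have ha : ∃ t, arc n a = ⟨(a, 0), hn a⟩ :: t := by
        cases ht : arc n a with
        | nil =>
          have h2 := congrArg List.length ht
          have h3 := hn a
          simp [arc] at h2
          omega
        | cons x t =>
          refine ⟨t, ?_⟩
          have h2 : (arc n a)[0]? = some x := by rw [ht]; rfl
          rw [arc_getElem? n a 0 (hn a)] at h2
          rw [Option.some.inj h2]
      obtain ⟨t, ht⟩ := ha
      rw [List.flatMap_cons, ht, List.cons_append, Cycle.chain_coe_cons]
      rw [List.flatMap_cons, List.flatMap_append, List.flatMap_singleton, ht] at h1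
      have h4 : (((⟨(a, 0), hn a⟩ : SubdivEdge n) :: t) ++
          (l.flatMap (arc n) ++ ⟨(a, 0), hn a⟩ :: t)) =
          ((⟨(a, 0), hn a⟩ : SubdivEdge n) :: (t ++ l.flatMap (arc n) ++ [⟨(a, 0), hn a⟩])) ++ t := by
        simp
      rw [h4] at h1
      exact h1.left_of_append
  bdry_finv := by
    intro f
    rw [Y.bdry_finv]
    induction Y.bdry f with
    | nil => rfl
    | cons a l ih =>
      rw [List.map_cons, List.reverse_cons, List.flatMap_append, ih, List.flatMap_singleton,
        Y.arc_inv hinv, List.flatMap_cons, List.map_append, List.reverse_append]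

end TwoComplex

/-! ### Words, van Kampen 2-complexes, fillability -/

/-- Words in the letters `x₁^±, …, x_m^±`; the letter `(i, true)` is `x_i` and `(i, false)` is
its inverse. The inverse of a word `w` is `FreeGroup.invRev w`. -/
abbrev RelWord (m : ℕ) : Type := List (Fin m × Bool)

/-- The set `B_ℓ` of cyclically reduced words of length at most `ℓ`. -/
def relBall (m ℓ : ℕ) : Set (RelWord m) :=
  {w | FreeGroup.IsCyclicallyReduced w ∧ w.length ≤ ℓ}

theorem relBall_finite (m ℓ : ℕ) : (relBall m ℓ).Finite :=
  (List.finite_length_le (Fin m × Bool) ℓ).subset fun _ hw => hw.2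

/-- Labels turning the 2-complex `Y` into a van Kampen 2-complex with respect to `⟨x₁, …, x_m | R⟩`:
edges are labeled by generators and their inverses, faces by relators in `R` and their inverses,
and the label of a face is read along its boundary. -/
structure VanKampenLabeling {V E F : Type*} (Y : TwoComplex V E F) {m : ℕ}
    (R : Set (RelWord m)) where
  edgeLabel : E → Fin m × Bool
  faceLabel : F → RelWord m
  edgeLabel_inv : ∀ e, edgeLabel (Y.inv e) = ((edgeLabel e).1, !(edgeLabel e).2)
  faceLabel_mem : ∀ f, faceLabel f ∈ R ∨ FreeGroup.invRev (faceLabel f) ∈ R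
  faceLabel_finv : ∀ f, faceLabel (Y.finv f) = FreeGroup.invRev (faceLabel f)
  map_bdry : ∀ f, (Y.bdry f).map edgeLabel = faceLabel f

/-- Two different faces are a reducible pair if they have the same label and a common boundary
edge at the same position; the van Kampen 2-complex is reduced if there is no such pair. -/
def VanKampenLabeling.IsReduced {V E F : Type*} {Y : TwoComplex V E F} {m : ℕ}
    {R : Set (RelWord m)} (φ : VanKampenLabeling Y R) : Prop :=
  ∀ f g : F, f ≠ g → φ.faceLabel f = φ.faceLabel g →
    ¬ ∃ (j : ℕ) (e : E), (Y.bdry f)[j]? = some e ∧ (Y.bdry g)[j]? = some e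

/-- `Y` is fillable by `R` if it underlies a reduced van Kampen 2-complex of `⟨x₁, …, x_m | R⟩`. -/
def Fillable {V E F : Type*} (Y : TwoComplex V E F) {m : ℕ} (R : Set (RelWord m)) : Prop :=
  ∃ φ : VanKampenLabeling Y R, φ.IsReduced

/-! ### Geometric forms -/

/-- A geometric form: a finite connected 2-complex without isolated edges, with at least one
face, and a length in `(0, 1]` for every geometric edge (that is, a function on oriented edges
invariant under inversion) such that all face boundaries have length at most `1`. -/
structure GeometricForm (V E F : Type*) extends TwoComplex V E F where
  finite_verts : Finite V
  finite_edges : Finite E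
  finite_faces : Finite F
  nonempty_faces : Nonempty F
  connected : toTwoComplex.Connected
  noIsolatedEdges : toTwoComplex.NoIsolatedEdges
  len : E → ℝ
  len_inv : ∀ e, len (inv e) = len e
  len_pos : ∀ e, 0 < len e
  len_le_one : ∀ e, len e ≤ 1
  bdry_len_le : ∀ f, ((bdry f).map len).sum ≤ 1

namespace GeometricForm

variable {V E F : Type*}

/-- The density of a sub-2-complex: total length of its geometric edges divided by its number of
geometric faces. Every geometric edge consists of two different oriented edges of the same
length, and every geometric face of two different oriented faces, hence the two halves. -/
noncomputable def dens (G : GeometricForm V E F) (Z : G.toTwoComplex.Sub) : ℝ :=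
  ((∑ᶠ e ∈ Z.edges, G.len e) / 2) / ((Z.faces.ncard : ℝ) / 2)

/-- The critical density: the minimum of the densities of the sub-2-complexes having a face
(it is attained, see `exists_dens_eq_densC`). -/
noncomputable def densC (G : GeometricForm V E F) : ℝ :=
  ⨅ Z : {Z : G.toTwoComplex.Sub // Z.faces.Nonempty}, G.dens Z.1

theorem finite_sub (G : GeometricForm V E F) : Finite G.toTwoComplex.Sub := by
  have := G.finite_verts
  have := G.finite_edges
  have := G.finite_faces
  refine Finite.of_injective
    (fun Z : G.toTwoComplex.Sub => (Z.verts, Z.edges, Z.faces)) ?_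
  intro Z W h
  simp only [Prod.mk.injEq] at h
  exact TwoComplex.Sub.ext h.1 h.2.1 h.2.2

theorem exists_dens_eq_densC (G : GeometricForm V E F) :
    ∃ Z : G.toTwoComplex.Sub, Z.faces.Nonempty ∧ G.dens Z = G.densC := by
  have := G.finite_sub
  have : Nonempty {Z : G.toTwoComplex.Sub // Z.faces.Nonempty} :=
    ⟨⟨TwoComplex.Sub.top _, G.nonempty_faces.elim fun f => ⟨f, Set.mem_univ f⟩⟩⟩
  obtain ⟨Z, hZ⟩ := exists_eq_ciInf_of_finite
    (f := fun Z : {Z : G.toTwoComplex.Sub // Z.faces.Nonempty} => G.dens Z.1)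
  exact ⟨Z.1, Z.2, hZ⟩

theorem densC_le (G : GeometricForm V E F) (Z : G.toTwoComplex.Sub) (hZ : Z.faces.Nonempty) :
    G.densC ≤ G.dens Z := by
  have := G.finite_sub
  exact ciInf_le (Set.finite_range _).bddBelow
    (⟨Z, hZ⟩ : {Z : G.toTwoComplex.Sub // Z.faces.Nonempty})

/-- The number of unit edges into which the edge `e` is divided: `⌊len e * ℓ⌋`. This is positive
for all large `ℓ`; the value `1` in place of `0` only occurs for the finitely many small `ℓ` for
which some edge would be divided into no edge at all. -/
noncomputable def numEdges (G : GeometricForm V E F) (ℓ : ℕ) (e : E) : ℕ :=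
  max 1 ⌊G.len e * ℓ⌋₊

/-- The sequence `(Y_ℓ)` of 2-complexes of the given geometric form. -/
noncomputable def complex (G : GeometricForm V E F) (ℓ : ℕ) :
    TwoComplex (TwoComplex.SubdivVert G.toTwoComplex (G.numEdges ℓ))
      (TwoComplex.SubdivEdge (G.numEdges ℓ)) F :=
  G.toTwoComplex.subdivide (G.numEdges ℓ)
    (fun e => by simp only [numEdges, G.len_inv])
    (fun _ => lt_of_lt_of_le Nat.one_pos (le_max_left _ _))

end GeometricForm

/-! ### Random subsets with density -/

/-- The density `log_{|α|} |S|` of a subset `S` of a finite set `α`, with value `-∞` for the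
empty set. -/
noncomputable def setDens {α : Type*} (S : Set α) : EReal :=
  open Classical in
  if S = ∅ then ⊥ else ((Real.logb (Nat.card α) S.ncard : ℝ) : EReal)

/-- A sequence of random groups `G_ℓ(m, d) = ⟨x₁, …, x_m | R_ℓ⟩` at density `d`, given by its sets
of relators: `R_ℓ` is a random subset of `B_ℓ`, defined on a probability space `(Ω_ℓ, P_ℓ)`. -/
structure IsRandomGroupSeq {m : ℕ} {Ω : ℕ → Type*} [∀ ℓ, MeasurableSpace (Ω ℓ)]
    (P : ∀ ℓ, Measure (Ω ℓ)) (R : ∀ ℓ, Ω ℓ → Set (relBall m ℓ)) (d : EReal) : Prop where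
  /-- `R_ℓ` is a random variable with values in the finite set of subsets of `B_ℓ`. -/
  measurable : ∀ ℓ (S : Set (relBall m ℓ)), MeasurableSet {ω | R ℓ ω = S}
  /-- The law of `R_ℓ` is invariant under all permutations of `B_ℓ`. -/
  perm_invariant : ∀ ℓ (σ : Equiv.Perm (relBall m ℓ)) (S : Set (relBall m ℓ)),
    P ℓ {ω | R ℓ ω = σ '' S} = P ℓ {ω | R ℓ ω = S}
  /-- The density lies in `{-∞} ∪ [0, 1]`. -/
  density_mem : d = ⊥ ∨ (0 ≤ d ∧ d ≤ 1)
  /-- The random densities of the `R_ℓ` in `B_ℓ` converge in probability to `d`. -/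
  densable : ∀ U ∈ 𝓝 d, Tendsto (fun ℓ => P ℓ {ω | setDens (R ℓ ω) ∈ U}) atTop (𝓝 1)

/-- The relators of a random set `R ⊆ B_ℓ`, as a set of words. -/
def relators {m ℓ : ℕ} (R : Set (relBall m ℓ)) : Set (RelWord m) := Subtype.val '' R

/-- The events `Q_ℓ` hold asymptotically almost surely. -/
def AsymptoticallyAlmostSurely {Ω : ℕ → Type*} [∀ ℓ, MeasurableSpace (Ω ℓ)]
    (P : ∀ ℓ, Measure (Ω ℓ)) (Q : ∀ ℓ, Ω ℓ → Prop) : Prop :=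
  Tendsto (fun ℓ => P ℓ {ω | Q ℓ ω}) atTop (𝓝 1)

/-! Write q = 2m-1, n = |B_ℓ| and δ = dens_c(Y). Up to factors polynomial in ℓ, n is q^ℓ. Given its
size r, the exchangeable set R_ℓ is a uniform r-subset of B_ℓ (`measure_le_of_exchangeable`). The
density allows one to assume r ≤ n^d' in (i) and r ≥ n^d' in (ii), for a real d' strictly between d
and 1-δ. Both parts thus become counts of r-subsets, where k given words lie in a proportion of
about (r/n)^k of them.

Part (i) is a first moment argument. Take Z of density δ and read the face boundaries of a reduced
filling in a fixed order. A letter is free only if its edge was not read before, and reducedness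
makes every geometric edge free at most once (`two_mul_sum_card_freePositions_le`), so there are
about ℓδ free letters per face. Since faces may share a relator, the average must be taken over
distinct relators. If these are ordered by decreasing multiplicity, some initial segment of k
relators has at most ℓδ free letters on average (`exists_initial_segment`), and earlier occurrences
of its edges stay inside it. So at most (const · q^(ℓδ))^k sets of k words can occur there
(`exists_relator_family`), and the union bound (const · q^(ℓδ) · r/n)^k tends to 0
(`ncard_fillable_le`).

Part (ii) is a second moment argument (`card_forall_not_subset_le`). From a filling by B_ℓ only the
first and last letters of the edge words are kept. Bounded prefixes are inserted that tell the
oriented edges apart, and the other letters are free up to a bounded number per edge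
(`exists_label_family`). Every choice fills Y_ℓ with distinct face labels. Prescribing the labels on
a set J of geometric faces prescribes all free letters on its edges, at least ℓδ|J| - const of them
by definition of δ (`densC_mul_card_le_sum_numFree`). So a proportion of at most const · q^(-ℓδ|J|)
of the family shares such labels, against a factor (n/r)^|J| in the second moment. As (n/r) ·
q^(-ℓδ) tends to 0, the variance is negligible (`ncard_not_fillable_le`). -/

/-! ### Exchangeable random subsets and counting. -/

section Probability

/-- Two finite sets of the same size are related by a permutation. -/
theorem exists_perm_image_eq {α : Type*} [Fintype α] [DecidableEq α] {S T : Finset α}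
    (h : S.card = T.card) : ∃ σ : Equiv.Perm α, σ '' (S : Set α) = T := by
  let e : {x // x ∈ S} ≃ {x // x ∈ T} := Finset.equivOfCardEq h
  refine ⟨e.extendSubtype, ?_⟩
  ext y
  constructor
  · rintro ⟨x, hx, rfl⟩
    exact e.extendSubtype_mem x hx
  · intro hy
    refine ⟨e.symm ⟨y, hy⟩, (e.symm ⟨y, hy⟩).2, ?_⟩
    rw [Equiv.extendSubtype_apply_of_mem _ _ (e.symm ⟨y, hy⟩).2]
    simp

/-- The probability of a property of an exchangeable random subset, restricted to some allowed
cardinalities, is at most `ε` if for every allowed cardinality at most the proportion `ε` of all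
subsets of that cardinality have the property. -/
theorem measure_le_of_exchangeable {α Ω : Type*} [Fintype α] [DecidableEq α] [MeasurableSpace Ω]
    (P : Measure Ω) [IsProbabilityMeasure P] (R : Ω → Set α)
    (hmeas : ∀ S : Set α, MeasurableSet {ω | R ω = S})
    (hperm : ∀ (σ : Equiv.Perm α) (S : Set α), P {ω | R ω = σ '' S} = P {ω | R ω = S})
    (C : ℕ → Prop) (Q : Set α → Prop) (ε : ℝ)
    (hε : 0 ≤ ε) (hQ : ∀ r, C r → (Set.ncard {S : Finset α | S.card = r ∧ Q S} : ℝ) ≤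
      ε * (Fintype.card α).choose r) :
    P.real {ω | C (R ω).ncard ∧ Q (R ω)} ≤ ε := by
  classical
  let p : Finset α → ℝ := fun S => P.real {ω | R ω = S}
  have hp : ∀ S, 0 ≤ p S := fun S => measureReal_nonneg
  have hprob : ∀ A : Set α → Prop,
      P.real {ω | A (R ω)} = ∑ S ∈ Finset.univ.filter (fun S : Finset α => A S), p S := by
    intro A
    have h1 : {ω | A (R ω)} =
        ⋃ S ∈ Finset.univ.filter (fun S : Finset α => A S), {ω | R ω = (S : Set α)} := by
      ext ω
      simp only [Set.mem_ofPred_eq, Finset.mem_filter, Finset.mem_univ, true_and,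
        Set.mem_iUnion, exists_prop]
      constructor
      · intro h
        exact ⟨(R ω).toFinset, by simpa using h, by simp⟩
      · rintro ⟨S, hS, h⟩
        rwa [h]
    rw [h1, measureReal_biUnion_finset]
    · intro S _ T _ hST
      refine Set.disjoint_left.2 fun ω h1 h2 => hST ?_
      simp only [Set.mem_ofPred_eq] at h1 h2
      exact_mod_cast h1.symm.trans h2
    · intro S _
      exact hmeas _
  have hcard : ∀ S T : Finset α, S.card = T.card → p S = p T := by
    intro S T h
    obtain ⟨σ, hσ⟩ := exists_perm_image_eq h
    simp only [p, measureReal_def]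
    rw [← hσ, hperm]
  -- The common probability of all r-subsets, with default 0 for sizes that no subset has.
  let q : ℕ → ℝ := fun r => if h : ∃ S : Finset α, S.card = r then p h.choose else 0
  have hq : ∀ S : Finset α, p S = q S.card := by
    intro S
    have h : ∃ T : Finset α, T.card = S.card := ⟨S, rfl⟩
    simp only [q, dif_pos h]
    exact hcard _ _ h.choose_spec.symm
  have hq0 : ∀ r, 0 ≤ q r := by
    intro r
    simp only [q]
    split_ifs
    exacts [hp _, le_rfl]
  -- The r-th summand is the probability that the random set has r elements.
  have htot : ∑ r ∈ Finset.range (Fintype.card α + 1), q r * (Fintype.card α).choose r = 1 := by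
    have h1 := hprob (fun _ => True)
    simp only [Set.ofPred_true, probReal_univ, Finset.filter_true] at h1
    rw [h1, ← Finset.sum_fiberwise_of_maps_to (s := Finset.univ)
      (t := Finset.range (Fintype.card α + 1)) (g := Finset.card)]
    · refine Finset.sum_congr rfl fun r _ => ?_
      rw [Finset.sum_congr rfl (g := fun _ => q r)]
      · have h2 : Finset.univ.filter (fun S : Finset α => S.card = r) =
            Finset.powersetCard r Finset.univ := by
          ext S; simp [Finset.mem_powersetCard]
        rw [h2, Finset.sum_const, Finset.card_powersetCard, Finset.card_univ, nsmul_eq_mul,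
          mul_comm]
      · intro S hS
        rw [hq S, (Finset.mem_filter.1 hS).2]
    · intro S _
      exact Finset.mem_range.2 (Nat.lt_succ_of_le (Finset.card_le_univ S))
  rw [hprob (fun S => C S.ncard ∧ Q S), ← Finset.sum_fiberwise_of_maps_to
      (t := Finset.range (Fintype.card α + 1)) (g := Finset.card)
      (fun S _ => Finset.mem_range.2 (Nat.lt_succ_of_le (Finset.card_le_univ S)))]
  calc _ ≤ ∑ r ∈ Finset.range (Fintype.card α + 1), ε * (q r * (Fintype.card α).choose r) := by
        refine Finset.sum_le_sum fun r _ => ?_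
        by_cases hr : C r
        · refine (Finset.sum_congr rfl (g := fun _ => q r) fun S hS => ?_).le.trans ?_
          · rw [hq S, (Finset.mem_filter.1 hS).2]
          · rw [Finset.sum_const, nsmul_eq_mul, ← Set.ncard_coe_finset]
            refine le_trans (mul_le_mul_of_nonneg_right ?_ (hq0 r))
              (by rw [mul_assoc, mul_comm (q r)] : ε * (Fintype.card α).choose r * q r ≤ _)
            refine le_trans (Nat.cast_le.2 (Set.ncard_le_ncard ?_ (Set.toFinite _))) (hQ r hr)
            intro S hS
            simp only [Finset.coe_filter, Finset.mem_filter, Finset.mem_univ, true_and,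
              Set.mem_ofPred_eq] at hS ⊢
            exact ⟨hS.2, hS.1.2⟩
        · rw [Finset.sum_eq_zero_iff_of_nonneg (fun S _ => hp S) |>.2]
          · exact mul_nonneg hε (mul_nonneg (hq0 r) (Nat.cast_nonneg _))
          · intro S hS
            simp only [Finset.mem_filter, Finset.mem_univ, true_and, Set.ncard_coe_finset] at hS
            exact absurd (hS.2 ▸ hS.1.1) hr
    _ = ε := by rw [← Finset.mul_sum, htot, mul_one]

end Probability

/-! ### Uniform r-subsets: first and second moments. -/

section Subsets

variable {α : Type*} [Fintype α]

/-- The proportion of the `r`-subsets of an `n`-set that contain a given `i`-subset. -/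
noncomputable def containRatio (n r i : ℕ) : ℝ := (r.choose i : ℝ) / n.choose i

theorem containRatio_nonneg (n r i : ℕ) : 0 ≤ containRatio n r i := by
  unfold containRatio; positivity

/-- There are C(n-t, r-t) such subsets, and C(n,r) C(r,t) = C(n,t) C(n-t, r-t). For t > r both sides
vanish. -/
theorem card_superset (T : Finset α) (r : ℕ) :
    (Set.ncard {S : Finset α | S.card = r ∧ T ⊆ S} : ℝ) =
      containRatio (Fintype.card α) r T.card * (Fintype.card α).choose r := by
  classical
  have hT : T.card ≤ Fintype.card α := Finset.card_le_univ T
  have h0 : {S : Finset α | S.card = r ∧ T ⊆ S} =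
      ((Finset.univ.powersetCard r).filter (T ⊆ ·) : Finset (Finset α)) := by
    ext S; simp [Finset.mem_powersetCard]
  rw [h0, Set.ncard_coe_finset, containRatio]
  have hpos : (0 : ℝ) < (Fintype.card α).choose T.card := by
    exact_mod_cast Nat.choose_pos hT
  rcases le_or_gt T.card r with h | h
  · rw [Finset.card_filter_powersetCard_subset _ _ _ (Finset.subset_univ _) h, Finset.card_univ]
    rw [div_mul_eq_mul_div, eq_div_iff hpos.ne', mul_comm (r.choose _ : ℝ)]
    have h1 := Nat.choose_mul (n := Fintype.card α) h
    rw [mul_comm]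
    exact_mod_cast h1.symm
  · rw [Nat.choose_eq_zero_of_lt h, Finset.filter_eq_empty_iff.2]
    · simp
    · intro S hS hTS
      have := Finset.card_le_card hTS
      rw [(Finset.mem_powersetCard.1 hS).2] at this
      omega

theorem containRatio_eq_descFactorial (n r i : ℕ) :
    containRatio n r i = (r.descFactorial i : ℝ) / n.descFactorial i := by
  rw [containRatio, Nat.descFactorial_eq_factorial_mul_choose,
    Nat.descFactorial_eq_factorial_mul_choose]
  push_cast
  rw [mul_div_mul_left]
  exact_mod_cast Nat.factorial_ne_zero i

/-- Sampling without replacement: once i elements are known to be contained, the remaining ones form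
an (r-i)-subset of an (n-i)-set. -/
theorem containRatio_add (n r i j : ℕ) :
    containRatio n r (i + j) = containRatio (n - i) (r - i) j * containRatio n r i := by
  have h : ∀ a : ℕ, a.descFactorial (i + j) = (a - i).descFactorial j * a.descFactorial i := by
    intro a
    rw [← Nat.descFactorial_mul_descFactorial (Nat.le_add_right i j), Nat.add_sub_cancel_left]
  simp only [containRatio_eq_descFactorial, h, Nat.cast_mul, mul_div_mul_comm]

/-- Since r ≤ n, (r-i)/(n-i) ≤ r/n: known elements make a further one less likely. This is the
source of the negative correlation used below. -/
theorem containRatio_one_le {n r : ℕ} (h : r ≤ n) (i : ℕ) :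
    containRatio (n - i) (r - i) 1 ≤ containRatio n r 1 := by
  simp only [containRatio, Nat.choose_one_right]
  rcases le_or_gt r i with hi | hi
  · rw [Nat.sub_eq_zero_of_le hi]; simp; positivity
  · rw [div_le_div_iff₀ (by norm_cast; omega) (by norm_cast; omega)]
    rw [Nat.cast_sub hi.le, Nat.cast_sub (by omega)]
    have : (r : ℝ) ≤ n := by exact_mod_cast h
    have : (0 : ℝ) ≤ i := by positivity
    nlinarith

theorem containRatio_le_pow {n r : ℕ} (h : r ≤ n) (i : ℕ) :
    containRatio n r i ≤ ((r : ℝ) / n) ^ i := by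
  induction i with
  | zero => simp [containRatio]
  | succ i ih =>
    rw [containRatio_add, pow_succ, mul_comm]
    refine mul_le_mul ih ?_ (containRatio_nonneg _ _ _) (by positivity)
    refine (containRatio_one_le h i).trans ?_
    simp [containRatio]

/-- Each of the k factors r-j in the numerator is at least r/2, and each factor n-j in the
denominator is at most n. The loss 2^k is harmless because k stays bounded as ℓ grows. -/
theorem pow_le_containRatio {n r k : ℕ} (h : r ≤ n) (hk : 2 * k ≤ r) :
    ((r : ℝ) / (2 * n)) ^ k ≤ containRatio n r k := by
  rw [containRatio_eq_descFactorial, div_pow]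
  rcases Nat.eq_zero_or_pos k with rfl | hk0
  · simp
  have hn : 0 < n.descFactorial k := Nat.descFactorial_pos.2 (by omega)
  have hn0 : (0 : ℝ) < n := by norm_cast; omega
  rw [div_le_div_iff₀ (by positivity) (by exact_mod_cast hn), mul_pow]
  have h1 : (n.descFactorial k : ℝ) ≤ (n : ℝ) ^ k := by exact_mod_cast Nat.descFactorial_le_pow n k
  have h2 : ((r + 1 - k : ℕ) : ℝ) ^ k ≤ r.descFactorial k := by
    exact_mod_cast Nat.pow_sub_le_descFactorial r k
  have h3 : (r : ℝ) ≤ 2 * ((r + 1 - k : ℕ) : ℝ) := by exact_mod_cast (by omega)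
  calc (r : ℝ) ^ k * n.descFactorial k ≤ (2 * ((r + 1 - k : ℕ) : ℝ)) ^ k * (n : ℝ) ^ k := by gcongr
    _ = ((r + 1 - k : ℕ) : ℝ) ^ k * (2 ^ k * (n : ℝ) ^ k) := by rw [mul_pow]; ring
    _ ≤ _ := by gcongr

theorem containRatio_sub_le {n r : ℕ} (h : r ≤ n) (i k : ℕ) :
    containRatio (n - i) (r - i) k ≤ containRatio n r k := by
  induction k with
  | zero => simp [containRatio]
  | succ k ih =>
    rw [containRatio_add, containRatio_add n r]
    refine mul_le_mul ?_ ih (containRatio_nonneg _ _ _) (containRatio_nonneg _ _ _)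
    have h1 := containRatio_one_le (n := n - k) (r := r - k) (by omega) i
    rwa [Nat.sub_right_comm, Nat.sub_right_comm r] at h1

/-- Negative correlation for disjoint k-sets, so that disjoint pairs contribute nothing positive to
the variance. -/
theorem containRatio_two_mul_le {n r : ℕ} (h : r ≤ n) (k : ℕ) :
    containRatio n r (2 * k) ≤ containRatio n r k ^ 2 := by
  rw [two_mul, containRatio_add, sq]
  exact mul_le_mul_of_nonneg_right (containRatio_sub_le h k k) (containRatio_nonneg _ _ _)


/-- Union bound for the proportion of the `r`-subsets that contain a member of a family. -/
theorem card_exists_superset_le {ι : Type*} {r : ℕ} (hr : r ≤ Fintype.card α) (s : Finset ι)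
    (T : ι → Finset α) :
    (Set.ncard {S : Finset α | S.card = r ∧ ∃ i ∈ s, T i ⊆ S} : ℝ) ≤
      (∑ i ∈ s, ((r : ℝ) / Fintype.card α) ^ (T i).card) * (Fintype.card α).choose r := by
  classical
  have h1 : {S : Finset α | S.card = r ∧ ∃ i ∈ s, T i ⊆ S} =
      ⋃ i ∈ s, {S : Finset α | S.card = r ∧ T i ⊆ S} := by
    ext S
    simp
  rw [h1, Finset.sum_mul]
  calc _ ≤ ((∑ i ∈ s, Set.ncard {S : Finset α | S.card = r ∧ T i ⊆ S} : ℕ) : ℝ) := by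
        exact_mod_cast Finset.set_ncard_biUnion_le _ _
    _ ≤ _ := by
        push_cast
        refine Finset.sum_le_sum fun i _ => ?_
        rw [card_superset]
        exact mul_le_mul_of_nonneg_right (containRatio_le_pow hr _) (Nat.cast_nonneg _)

/-- Second moment method: if pairs of intersecting members of the family `H` are rare, most
`r`-subsets contain a member of the family. -/
theorem card_forall_not_subset_le {Θ : Type*} [Fintype Θ] [Nonempty Θ] [DecidableEq α]
    (H : Θ → Finset α) {k r : ℕ} (hH : ∀ t, (H t).card = k) (hr : r ≤ Fintype.card α)
    (hk : 2 * k ≤ r) (hr0 : 0 < r) {ε : ℝ}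
    (hε : ∀ t, ∑ t' ∈ Finset.univ.filter (fun t' => ¬ Disjoint (H t) (H t')),
      ((Fintype.card α : ℝ) / r) ^ (H t ∩ H t').card ≤ ε * Fintype.card Θ) :
    (Set.ncard {S : Finset α | S.card = r ∧ ∀ t, ¬ H t ⊆ S} : ℝ) ≤
      4 ^ k * ε * (Fintype.card α).choose r := by
  set n := Fintype.card α with hn
  set A : ℝ := (Fintype.card Θ : ℝ) with hA
  set C : ℝ := (n.choose r : ℝ) with hC
  have hA0 : 0 < A := by simp [hA, Fintype.card_pos]
  have hC0 : 0 < C := by simp [hC, Nat.choose_pos hr]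
  have hn0 : 0 < n := by omega
  set 𝒮 : Finset (Finset α) := Finset.univ.powersetCard r with h𝒮
  have hcount : ∀ T : Finset α,
      ∑ S ∈ 𝒮, (if T ⊆ S then (1 : ℝ) else 0) = containRatio n r T.card * C := by
    intro T
    rw [hn, hC, ← card_superset, ← Finset.sum_filter, Finset.sum_const, nsmul_eq_mul, mul_one,
      ← Set.ncard_coe_finset]
    congr 2
    ext S
    simp [h𝒮, Finset.mem_powersetCard]
  -- The number of members of the family contained in S; its mean and second moment over all
  -- r-subsets are computed next.
  let X : Finset α → ℝ := fun S => ∑ t, if H t ⊆ S then (1 : ℝ) else 0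
  have hX1 : ∑ S ∈ 𝒮, X S = A * containRatio n r k * C := by
    simp only [X]
    rw [Finset.sum_comm]
    simp only [hcount, hH, Finset.sum_const, Finset.card_univ, nsmul_eq_mul]
    ring
  set w : ℝ := ((r : ℝ) / n) ^ (2 * k) with hw
  have hw0 : 0 < w := by positivity
  -- Intersecting pairs have |H t ∪ H t'| = 2k - |H t ∩ H t'|, which yields the factor n/r for every
  -- shared element.
  have hpair : ∀ t t', containRatio n r (H t ∪ H t').card ≤ containRatio n r k ^ 2 +
      if ¬ Disjoint (H t) (H t') then w * ((n : ℝ) / r) ^ (H t ∩ H t').card else 0 := by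
    intro t t'
    have h1 := Finset.card_union_add_card_inter (H t) (H t')
    rw [hH, hH] at h1
    by_cases hd : Disjoint (H t) (H t')
    · rw [Finset.disjoint_iff_inter_eq_empty.1 hd, Finset.card_empty] at h1
      rw [if_neg (not_not.2 hd), add_zero, show (H t ∪ H t').card = 2 * k by omega]
      exact containRatio_two_mul_le hr k
    · rw [if_pos hd]
      refine le_add_of_nonneg_of_le (sq_nonneg _) ((containRatio_le_pow hr _).trans ?_)
      rw [hw, show 2 * k = (H t ∪ H t').card + (H t ∩ H t').card by omega, pow_add, mul_assoc,
        ← mul_pow, div_mul_div_cancel₀, div_self, one_pow, mul_one] <;> positivity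
  have hX2 : ∑ S ∈ 𝒮, X S ^ 2 ≤ C * (A ^ 2 * containRatio n r k ^ 2 + A ^ 2 * ε * w) := by
    have h1 : ∀ S, X S ^ 2 = ∑ t, ∑ t', if H t ∪ H t' ⊆ S then (1 : ℝ) else 0 := by
      intro S
      simp only [X, sq, Finset.sum_mul_sum, Finset.union_subset_iff, ite_and, ite_mul, one_mul,
        zero_mul]
    simp only [h1]
    rw [Finset.sum_comm]
    simp_rw [Finset.sum_comm (s := 𝒮), hcount]
    rw [mul_comm C]
    simp_rw [← Finset.sum_mul]
    refine mul_le_mul_of_nonneg_right ?_ hC0.le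
    calc _ ≤ ∑ t, ∑ t', (containRatio n r k ^ 2 +
          if ¬ Disjoint (H t) (H t') then w * ((n : ℝ) / r) ^ (H t ∩ H t').card else 0) :=
          Finset.sum_le_sum fun t _ => Finset.sum_le_sum fun t' _ => hpair t t'
      _ ≤ ∑ t : Θ, (A * containRatio n r k ^ 2 + w * (ε * A)) := by
          refine Finset.sum_le_sum fun t _ => ?_
          rw [Finset.sum_add_distrib, Finset.sum_const, Finset.card_univ, nsmul_eq_mul,
            ← Finset.sum_filter, ← Finset.mul_sum]
          exact add_le_add_right (mul_le_mul_of_nonneg_left (hε t) hw0.le) _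
      _ = _ := by
          rw [Finset.sum_const, Finset.card_univ, nsmul_eq_mul]
          ring
  set M : ℝ := A * containRatio n r k with hM
  have hvar : ∑ S ∈ 𝒮, (X S - M) ^ 2 ≤ C * (A ^ 2 * ε * w) := by
    have h1 : ∑ S ∈ 𝒮, (X S - M) ^ 2 = ∑ S ∈ 𝒮, X S ^ 2 - 2 * M * ∑ S ∈ 𝒮, X S + C * M ^ 2 := by
      have h2 : (𝒮.card : ℝ) = C := by rw [h𝒮, Finset.card_powersetCard, Finset.card_univ]
      simp only [sub_sq, Finset.sum_add_distrib, Finset.sum_sub_distrib, Finset.sum_const,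
        nsmul_eq_mul, h2, Finset.mul_sum]
      congr 2
      exact Finset.sum_congr rfl fun S _ => by ring
    rw [h1, hX1]
    rw [hM]
    linarith [hX2]
  set N : Finset (Finset α) := 𝒮.filter (fun S => ∀ t, ¬ H t ⊆ S) with hN
  have hN1 : (Set.ncard {S : Finset α | S.card = r ∧ ∀ t, ¬ H t ⊆ S} : ℝ) = N.card := by
    rw [← Set.ncard_coe_finset]
    congr 2
    ext S
    simp [hN, h𝒮, Finset.mem_powersetCard]
  -- Chebyshev: a subset without any member has X = 0, hence contributes M² to the variance sum.
  have hN2 : (N.card : ℝ) * M ^ 2 ≤ C * (A ^ 2 * ε * w) := by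
    refine le_trans ?_ hvar
    rw [← nsmul_eq_mul, ← Finset.sum_const]
    refine (Finset.sum_le_sum fun S hS => ?_).trans
      (Finset.sum_le_sum_of_subset_of_nonneg (Finset.filter_subset _ _) fun _ _ _ => sq_nonneg _)
    have h1 : X S = 0 := Finset.sum_eq_zero fun t _ => if_neg ((Finset.mem_filter.1 hS).2 t)
    rw [h1, zero_sub, neg_sq]
  have hM2 : A ^ 2 * w / 4 ^ k ≤ M ^ 2 := by
    have h1 := pow_le_containRatio hr hk
    have h2 : w / 4 ^ k = (((r : ℝ) / (2 * n)) ^ k) ^ 2 := by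
      rw [hw, pow_mul, ← div_pow, ← pow_mul, mul_comm k 2, pow_mul]
      congr 1
      field_simp
      norm_num
    rw [hM, mul_pow, mul_div_assoc, h2]
    gcongr
  rw [hN1]
  have h3 : (N.card : ℝ) * (A ^ 2 * w / 4 ^ k) ≤ C * (A ^ 2 * ε * w) :=
    (mul_le_mul_of_nonneg_left hM2 (Nat.cast_nonneg _)).trans hN2
  have h4 : 0 < A ^ 2 * w / 4 ^ k := by positivity
  refine le_of_mul_le_mul_right (h3.trans (le_of_eq ?_)) h4
  field_simp

end Subsets

/-! ### Reduced words: encoding, extension and the size of the ball. -/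

section Words

variable {m : ℕ}

/-- The inverse letter. -/
def letterInv (a : Fin m × Bool) : Fin m × Bool := (a.1, !a.2)

@[simp]
theorem letterInv_letterInv (a : Fin m × Bool) : letterInv (letterInv a) = a := by
  simp [letterInv]

theorem letterInv_ne (a : Fin m × Bool) : letterInv a ≠ a := by
  intro h
  have := congrArg Prod.snd h
  simp [letterInv] at this

theorem not_cancel_iff {a b : Fin m × Bool} : (a.1 = b.1 → a.2 = b.2) ↔ b ≠ letterInv a := by
  obtain ⟨i, s⟩ := a
  obtain ⟨j, t⟩ := b
  simp only [letterInv, ne_eq, Prod.mk.injEq, not_and]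
  constructor
  · rintro h rfl ht
    rw [← h rfl] at ht
    cases s <;> simp at ht
  · rintro h rfl
    have := h rfl
    revert this
    cases s <;> cases t <;> simp

theorem isReduced_iff_isChain {w : RelWord m} :
    FreeGroup.IsReduced w ↔ List.IsChain (fun a b => b ≠ letterInv a) w := by
  unfold FreeGroup.IsReduced
  simp only [not_cancel_iff]

/-- The only new junction in w ++ w is that of the last with the first letter, so cyclic reducedness
becomes a linear condition. -/
theorem isCyclicallyReduced_iff_append_self {w : RelWord m} :
    FreeGroup.IsCyclicallyReduced w ↔ FreeGroup.IsReduced (w ++ w) := by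
  unfold FreeGroup.IsCyclicallyReduced FreeGroup.IsReduced
  rw [List.isChain_append]
  tauto

theorem isReduced_invRev {w : RelWord m} (h : FreeGroup.IsReduced w) :
    FreeGroup.IsReduced (FreeGroup.invRev w) := by
  unfold FreeGroup.IsReduced FreeGroup.invRev at *
  rw [List.isChain_reverse, List.isChain_map]
  refine h.imp ?_
  intro a b hab h1
  simp only at h1 ⊢
  rw [hab h1.symm]

/-- Enumeration of the letters that may follow the letter `a` in a reduced word. -/
noncomputable def nextLetter (a : Fin m × Bool) :
    Fin (2 * m - 1) ≃ {b : Fin m × Bool // b ≠ letterInv a} :=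
  (Fintype.equivFinOfCardEq (by
    rw [Fintype.card_subtype_compl]
    simp [mul_comm])).symm

/-- The index of the letter `b` among the letters that may follow `a`. -/
noncomputable def letterCode (a b : Fin m × Bool) : Fin (2 * m - 1) :=
  if h : b ≠ letterInv a then (nextLetter a).symm ⟨b, h⟩
  -- Default value for a forbidden b: the letter a may always follow itself.
  else (nextLetter a).symm ⟨a, (letterInv_ne a).symm⟩

theorem letterCode_inj {a b c : Fin m × Bool} (hb : b ≠ letterInv a) (hc : c ≠ letterInv a)
    (h : letterCode a b = letterCode a c) : b = c := by
  rw [letterCode, letterCode, dif_pos hb, dif_pos hc] at h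
  exact congrArg Subtype.val ((nextLetter a).symm.injective h)

/-- The number of tuples of reduced words of given lengths is bounded by the number of free
positions, if the letter at every other position is determined by the letter at an earlier
position. -/
theorem ncard_reduced_tuples_le (d : Fin m × Bool) {ι : Type*} [Fintype ι]
    (len κ : ι → ℕ) (free : Finset (ι × ℕ)) (𝓡 : Set (ι → RelWord m))
    (hlen : ∀ r ∈ 𝓡, ∀ i, (r i).length = len i)
    (hred : ∀ r ∈ 𝓡, ∀ i, FreeGroup.IsReduced (r i))
    (hdet : ∀ (i : ι) (j : ℕ), j < len i → (i, j) ∉ free → ∃ (i' : ι) (j' : ℕ), (κ i' < κ i ∨ (i' = i ∧ j' < j)) ∧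
      ∀ r ∈ 𝓡, ∀ s ∈ 𝓡, (r i')[j']? = (s i')[j']? → (r i)[j]? = (s i)[j]?) :
    𝓡.ncard ≤ (2 * m + 1) ^ Fintype.card ι * (2 * m - 1) ^ free.card := by
  classical
  -- First letters, with `none` for an empty word, give the factors 2m+1; a free letter is coded
  -- relative to its predecessor, giving 2m-1. At position 0 the truncated j - 1 makes the code
  -- useless, and the first letter takes over.
  let Φ : (ι → RelWord m) → (ι → Option (Fin m × Bool)) × (free → Fin (2 * m - 1)) := fun r =>
    (fun i => (r i).head?,
      fun p => letterCode ((r p.1.1).getD (p.1.2 - 1) d) ((r p.1.1).getD p.1.2 d))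
  have hinj : Set.InjOn Φ 𝓡 := by
    intro r hr s hs hrs
    have hhead : ∀ i, (r i).head? = (s i).head? := fun i => congrFun (congrArg Prod.fst hrs) i
    have hcode : ∀ i j, (i, j) ∈ free →
        letterCode ((r i).getD (j - 1) d) ((r i).getD j d) =
          letterCode ((s i).getD (j - 1) d) ((s i).getD j d) :=
      fun i j h => congrFun (congrArg Prod.snd hrs) ⟨(i, j), h⟩
    -- Induction on the rank `κ i`, and on the position inside a word, follows the order of the
    -- dependencies in `hdet`.
    have key : ∀ (n : ℕ) (i : ι), κ i = n → ∀ j : ℕ, (r i)[j]? = (s i)[j]? := by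
      intro n
      induction n using Nat.strong_induction_on with
      | _ n ihn =>
      intro i hi j
      induction j using Nat.strong_induction_on with
      | _ j ihj =>
      rcases le_or_gt (len i) j with hj | hj
      · rw [List.getElem?_eq_none (by rw [hlen r hr]; exact hj),
          List.getElem?_eq_none (by rw [hlen s hs]; exact hj)]
      by_cases hf : (i, j) ∈ free
      · cases j with
        | zero => rw [← List.head?_eq_getElem?, ← List.head?_eq_getElem?, hhead]
        | succ j =>
          have h1 := ihj j (Nat.lt_succ_self j)
          have hrj : j + 1 < (r i).length := by rw [hlen r hr]; exact hj
          have hsj : j + 1 < (s i).length := by rw [hlen s hs]; exact hj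
          have h2 := hcode i (j + 1) hf
          rw [Nat.add_sub_cancel, List.getD_eq_getElem _ _ hrj, List.getD_eq_getElem _ _ hsj,
            List.getD_eq_getElem _ _ (by omega), List.getD_eq_getElem _ _ (by omega)] at h2
          rw [List.getElem?_eq_getElem (by omega), List.getElem?_eq_getElem (by omega)] at h1
          rw [List.getElem?_eq_getElem hrj, List.getElem?_eq_getElem hsj]
          have hr' := (List.isChain_iff_getElem.1 (isReduced_iff_isChain.1 (hred r hr i))) j hrj
          have hs' := (List.isChain_iff_getElem.1 (isReduced_iff_isChain.1 (hred s hs i))) j hsj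
          rw [← Option.some.inj h1] at h2 hs'
          rw [letterCode_inj hr' hs' h2]
      · obtain ⟨i', j', hlt, hdet'⟩ := hdet i j hj hf
        refine hdet' r hr s hs ?_
        rcases hlt with hlt | ⟨rfl, hlt⟩
        · exact ihn _ (hi ▸ hlt) i' rfl j'
        · exact ihj j' hlt
    funext i
    exact List.ext_getElem? (key _ i rfl)
  calc 𝓡.ncard ≤ (Set.univ : Set ((ι → Option (Fin m × Bool)) × (free → Fin (2 * m - 1)))).ncard :=
        Set.ncard_le_ncard_of_injOn Φ (fun _ _ => Set.mem_univ _) hinj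
    _ = _ := by
      rw [Set.ncard_univ, Nat.card_eq_fintype_card]
      simp [mul_comm]

/-- For each length k ≤ ℓ the tuple count is applied to a single word all of whose positions are
free. -/
theorem card_relBall_le (hm : 1 ≤ m) (ℓ : ℕ) :
    Nat.card (relBall m ℓ) ≤ (ℓ + 1) * ((2 * m + 1) * (2 * m - 1) ^ ℓ) := by
  classical
  have hq : 1 ≤ 2 * m - 1 := by omega
  have h1 : relBall m ℓ ⊆ ⋃ k ∈ Finset.range (ℓ + 1),
      {w : RelWord m | FreeGroup.IsReduced w ∧ w.length = k} := by
    intro w hw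
    simp only [Set.mem_iUnion]
    exact ⟨w.length, Finset.mem_range.2 (Nat.lt_succ_of_le hw.2), hw.1.1, rfl⟩
  have hfin : ∀ k, {w : RelWord m | FreeGroup.IsReduced w ∧ w.length = k}.Finite := fun k =>
    (List.finite_length_eq _ k).subset fun _ hw => hw.2
  have h2 : ∀ k ≤ ℓ, {w : RelWord m | FreeGroup.IsReduced w ∧ w.length = k}.ncard ≤
      (2 * m + 1) * (2 * m - 1) ^ ℓ := by
    intro k hk
    have h3 := ncard_reduced_tuples_le (m := m) (⟨0, hm⟩, true) (ι := Unit) (fun _ => k) (fun _ => 0)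
      (Finset.univ ×ˢ Finset.range k) {r | FreeGroup.IsReduced (r ()) ∧ (r ()).length = k}
      (fun r hr _ => hr.2) (fun r hr _ => hr.1)
      (fun i j hj h => absurd (by simpa using hj) h)
    have h4 : {w : RelWord m | FreeGroup.IsReduced w ∧ w.length = k}.ncard ≤
        {r : Unit → RelWord m | FreeGroup.IsReduced (r ()) ∧ (r ()).length = k}.ncard := by
      refine Set.ncard_le_ncard_of_injOn (fun w _ => w) (fun w hw => hw)
        (fun a _ b _ hab => congrFun hab ()) ?_
      exact Set.Finite.of_injOn (f := fun r : Unit → RelWord m => r ()) (fun r hr => hr)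
        (fun a _ b _ hab => funext fun _ => hab) (hfin k)
    refine (h4.trans h3).trans ?_
    simp only [Fintype.card_unit, pow_one, Finset.card_product, Finset.card_univ, one_mul,
      Finset.card_range]
    exact Nat.mul_le_mul_left _ (Nat.pow_le_pow_right hq hk)
  rw [Nat.card_coe_set_eq]
  calc _ ≤ (⋃ k ∈ Finset.range (ℓ + 1),
        {w : RelWord m | FreeGroup.IsReduced w ∧ w.length = k}).ncard :=
        Set.ncard_le_ncard h1 ((Finset.range (ℓ + 1)).finite_toSet.biUnion fun k _ => hfin k)
    _ ≤ ∑ k ∈ Finset.range (ℓ + 1), {w : RelWord m | FreeGroup.IsReduced w ∧ w.length = k}.ncard :=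
        Finset.set_ncard_biUnion_le _ _
    _ ≤ ∑ _k ∈ Finset.range (ℓ + 1), (2 * m + 1) * (2 * m - 1) ^ ℓ :=
        Finset.sum_le_sum fun k hk => h2 k (Nat.lt_succ_iff.1 (Finset.mem_range.1 hk))
    _ = _ := by rw [Finset.sum_const, Finset.card_range, smul_eq_mul]

/-- The word read after the letter `a` when the successive letters are chosen according to the
given indices. -/
noncomputable def extendWord : Fin m × Bool → List (Fin (2 * m - 1)) → RelWord m
  | _, [] => []
  | a, c :: cs => (nextLetter a c).1 :: extendWord (nextLetter a c).1 cs

theorem length_extendWord (a : Fin m × Bool) (cs : List (Fin (2 * m - 1))) :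
    (extendWord a cs).length = cs.length := by
  induction cs generalizing a with
  | nil => rfl
  | cons c cs ih => simp [extendWord, ih]

theorem isReduced_cons_extendWord (a : Fin m × Bool) (cs : List (Fin (2 * m - 1))) :
    FreeGroup.IsReduced (a :: extendWord a cs) := by
  rw [isReduced_iff_isChain]
  induction cs generalizing a with
  | nil => simp [extendWord]
  | cons c cs ih =>
    rw [extendWord, List.isChain_cons_cons]
    exact ⟨(nextLetter a c).2, ih _⟩

theorem extendWord_injective (a : Fin m × Bool) : Function.Injective (extendWord a) := by
  intro cs ds h
  induction cs generalizing a ds with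
  | nil =>
    cases ds with
    | nil => rfl
    | cons d ds => simp [extendWord] at h
  | cons c cs ih =>
    cases ds with
    | nil => simp [extendWord] at h
    | cons d ds =>
      simp only [extendWord, List.cons.injEq] at h
      obtain ⟨h1, h2⟩ := h
      have h3 : c = d := (nextLetter a).injective (Subtype.ext h1)
      subst h3
      rw [ih _ h2]

/-- Only the inverses of a and b are excluded, and there are 2m ≥ 4 letters. -/
theorem exists_bridge (hm : 2 ≤ m) (a b : Fin m × Bool) :
    ∃ z, z ≠ letterInv a ∧ b ≠ letterInv z := by
  by_contra! h
  have h1 : (Finset.univ : Finset (Fin m × Bool)) ⊆ {letterInv a, letterInv b} := by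
    intro z _
    rw [Finset.mem_insert, Finset.mem_singleton]
    by_cases hz : z = letterInv a
    · exact Or.inl hz
    · exact Or.inr (by rw [h z hz, letterInv_letterInv])
  have h2 := (Finset.card_le_card h1).trans Finset.card_le_two
  rw [Finset.card_univ, Fintype.card_prod, Fintype.card_fin, Fintype.card_bool] at h2
  omega

/-- A letter that may stand between `a` and `b` in a reduced word. -/
noncomputable def bridge (hm : 2 ≤ m) (a b : Fin m × Bool) : Fin m × Bool :=
  (exists_bridge hm a b).choose

/-- A word leading from the letter `a` to the letter `b`: all letters but the last are chosen
according to the given indices. -/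
noncomputable def fillWord (hm : 2 ≤ m) (a : Fin m × Bool) (cs : List (Fin (2 * m - 1)))
    (b : Fin m × Bool) : RelWord m :=
  extendWord a cs ++ [bridge hm ((a :: extendWord a cs).getLast (by simp)) b]

theorem length_fillWord (hm : 2 ≤ m) (a b : Fin m × Bool) (cs : List (Fin (2 * m - 1))) :
    (fillWord hm a cs b).length = cs.length + 1 := by
  simp [fillWord, length_extendWord]

theorem isReduced_fillWord (hm : 2 ≤ m) (a b : Fin m × Bool) (cs : List (Fin (2 * m - 1))) :
    FreeGroup.IsReduced (a :: (fillWord hm a cs b ++ [b])) := by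
  have h := (exists_bridge hm ((a :: extendWord a cs).getLast (by simp)) b).choose_spec
  have h1 := isReduced_iff_isChain.1 (isReduced_cons_extendWord a cs)
  rw [isReduced_iff_isChain, fillWord, List.append_assoc, ← List.cons_append, List.isChain_append]
  refine ⟨h1, ?_, ?_⟩
  · simpa [bridge] using h.2
  · intro x hx y hy
    rw [List.getLast?_eq_getLast_of_ne_nil (by simp), Option.mem_some_iff] at hx
    simp only [List.cons_append, List.nil_append, List.head?_cons, Option.mem_some_iff] at hy
    rw [← hx, ← hy]
    exact h.1

theorem fillWord_injective (hm : 2 ≤ m) (a b : Fin m × Bool) :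
    Function.Injective fun cs => fillWord hm a cs b := by
  intro cs ds h
  exact extendWord_injective a (List.append_inj_left' h rfl)

/-- A fixed letter a, k free letters and one bridge back to a form a cyclically reduced word of
length k + 2. -/
theorem pow_le_card_relBall (hm : 2 ≤ m) (k : ℕ) :
    (2 * m - 1) ^ k ≤ Nat.card (relBall m (k + 2)) := by
  let a : Fin m × Bool := (⟨0, by omega⟩, true)
  have h : ∀ c : Fin k → Fin (2 * m - 1), a :: fillWord hm a (List.ofFn c) a ∈ relBall m (k + 2) := by
    intro c
    refine ⟨?_, by simp [length_fillWord]⟩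
    have h1 := isReduced_fillWord hm a a (List.ofFn c)
    rw [isCyclicallyReduced_iff_append_self]
    unfold FreeGroup.IsReduced at *
    rw [List.isChain_split]
    exact ⟨h1, (List.isChain_append.1 (by simpa using h1 : List.IsChain _
      ((a :: fillWord hm a (List.ofFn c) a) ++ [a]))).1⟩
  have := (relBall_finite m (k + 2)).to_subtype
  have h2 := Nat.card_le_card_of_injective
    (fun c => (⟨_, h c⟩ : relBall m (k + 2))) (by
      intro c d hcd
      have h3 := congrArg Subtype.val hcd
      simp only [List.cons.injEq, true_and] at h3
      exact List.ofFn_injective (fillWord_injective hm a a h3))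
  simpa using h2

end Words

/-! ### Free positions in reduced van Kampen 2-complexes. -/

section Upper

/-- A numbering of the fibers of `w` in which fibers with more elements in `S` come first. -/
theorem exists_numbering {F W : Type*} [Fintype F] [DecidableEq F] [DecidableEq W] (w : F → W)
    (S : Finset F) :
    ∃ κ : F → Fin (Fintype.card F * (Fintype.card F + 1)),
      (∀ f g, κ f = κ g ↔ w f = w g) ∧
      ∀ f g, κ f ≤ κ g →
        (S.filter fun h => κ h = κ g).card ≤ (S.filter fun h => κ h = κ f).card := by
  set N := Fintype.card F with hN
  let idx : F ≃ Fin N := Fintype.equivFin F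
  let c : F → F := fun f => (Quotient.mk (Setoid.ker w) f).out
  have hc : ∀ f g, c f = c g ↔ w f = w g := by
    intro f g
    constructor
    · intro h
      have h1 : Quotient.mk (Setoid.ker w) f = Quotient.mk (Setoid.ker w) g := Quotient.out_injective h
      exact Quotient.exact h1
    · intro h
      have h1 : Quotient.mk (Setoid.ker w) f = Quotient.mk (Setoid.ker w) g := Quotient.sound h
      simp only [c, h1]
  let μ : F → ℕ := fun f => (S.filter fun h => w h = w f).card
  have hμ : ∀ f, μ f ≤ N := fun f => Finset.card_le_univ _
  have hμw : ∀ f g, w f = w g → μ f = μ g := fun f g h => by simp only [μ, h]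
  -- A two-digit number in base N: the leading digit decreases with the multiplicity, the last digit
  -- separates fibers of equal multiplicity.
  let k : F → ℕ := fun f => (N - μ f) * N + idx (c f)
  have hk : ∀ f, k f < N * (N + 1) := by
    intro f
    have h1 := (idx (c f)).2
    have h2 : (N - μ f) * N ≤ N * N := Nat.mul_le_mul_right _ (Nat.sub_le _ _)
    calc k f < N * N + N := by simp only [k]; omega
      _ = _ := by ring
  have hkw : ∀ f g, k f = k g ↔ w f = w g := by
    intro f g
    constructor
    · intro h
      have h1 := (idx (c f)).2
      have h2 := (idx (c g)).2
      have h3 : k f % N = k g % N := by rw [h]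
      simp only [k, Nat.mul_add_mod_self_right, Nat.mod_eq_of_lt h1, Nat.mod_eq_of_lt h2] at h3
      exact (hc f g).1 (idx.injective (Fin.ext h3))
    · intro h
      simp only [k, (hc f g).2 h, hμw f g h]
  have hkμ : ∀ f g, k f ≤ k g → μ g ≤ μ f := by
    intro f g h
    by_contra! hlt
    have h1 : N - μ g + 1 ≤ N - μ f := by have := hμ g; omega
    have h2 := (idx (c g)).2
    have h3 : (N - μ g + 1) * N ≤ (N - μ f) * N := Nat.mul_le_mul_right _ h1
    have h4 : k g < (N - μ g + 1) * N := by
      simp only [k]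
      rw [add_mul, one_mul]
      omega
    have h5 : (N - μ f) * N ≤ k f := Nat.le_add_right _ _
    omega
  refine ⟨fun f => ⟨k f, hk f⟩, fun f g => by rw [Fin.mk.injEq, hkw], fun f g h => ?_⟩
  simp only [Fin.mk.injEq, hkw]
  exact hkμ f g h

/-- If the average of `y` over `S` is at most `x`, and the fibers of `κ` are ordered by decreasing
size, then there is an initial segment of fibers with representatives on which the average of `y`
is at most `x`. -/
theorem exists_initial_segment {F K : Type*} [LinearOrder K] (S : Finset F)
    (hS : S.Nonempty) (κ : F → K) (y : F → ℝ) (x : ℝ) (hsum : ∑ f ∈ S, y f ≤ x * S.card)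
    (hκ : ∀ f g, κ f ≤ κ g →
      (S.filter fun h => κ h = κ g).card ≤ (S.filter fun h => κ h = κ f).card) :
    ∃ I ⊆ S, I.Nonempty ∧ Set.InjOn κ I ∧
      (∀ i ∈ I, ∀ g ∈ S, κ g ≤ κ i → ∃ i' ∈ I, κ i' = κ g) ∧ ∑ f ∈ I, y f ≤ x * I.card := by
  classical
  have : Nonempty F := ⟨hS.choose⟩
  -- Each fiber is represented by a face minimizing `y`, so the average weighted by multiplicity
  -- does not increase.
  have hrep : ∀ n, n ∈ S.image κ → ∃ g, g ∈ S ∧ κ g = n ∧ ∀ g' ∈ S, κ g' = n → y g ≤ y g' := by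
    intro n hn
    obtain ⟨f, hf, rfl⟩ := Finset.mem_image.1 hn
    obtain ⟨g, hg, hmin⟩ := Finset.exists_min_image (S.filter fun h => κ h = κ f) y
      ⟨f, Finset.mem_filter.2 ⟨hf, rfl⟩⟩
    rw [Finset.mem_filter] at hg
    exact ⟨g, hg.1, hg.2, fun g' hg' hκ' => hmin g' (Finset.mem_filter.2 ⟨hg', hκ'⟩)⟩
  choose! rep hrepS hrepκ hrepmin using hrep
  let μ : K → ℕ := fun n => (S.filter fun h => κ h = n).card
  have hμpos : ∀ n ∈ S.image κ, 0 < μ n := by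
    intro n hn
    obtain ⟨f, hf, rfl⟩ := Finset.mem_image.1 hn
    exact Finset.card_pos.2 ⟨f, Finset.mem_filter.2 ⟨hf, rfl⟩⟩
  have hmaps : ∀ f ∈ S, κ f ∈ S.image κ := fun f hf => Finset.mem_image_of_mem κ hf
  have h1 : ∑ n ∈ S.image κ, (μ n : ℝ) * (y (rep n) - x) ≤ 0 := by
    have h2 : ∑ n ∈ S.image κ, (μ n : ℝ) * (y (rep n) - x) ≤ ∑ f ∈ S, (y f - x) := by
      rw [← Finset.sum_fiberwise_of_maps_to hmaps]
      refine Finset.sum_le_sum fun n hn => ?_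
      rw [← nsmul_eq_mul, ← Finset.sum_const]
      refine Finset.sum_le_sum fun f hf => ?_
      rw [Finset.mem_filter] at hf
      exact sub_le_sub_right (hrepmin n hn f hf.1 hf.2) _
    rw [Finset.sum_sub_distrib, Finset.sum_const, nsmul_eq_mul] at h2
    linarith [mul_comm x (S.card : ℝ)]
  -- Layer-cake: the sum weighted by multiplicities is the sum over t of the unweighted sums over
  -- the fibers with more than t elements, so some nonempty layer has sum at most 0. Layers are
  -- initial segments by `hκ`.
  have h2 : ∃ t ∈ Finset.range S.card, ((S.image κ).filter fun n => t < μ n).Nonempty ∧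
      ∑ n ∈ (S.image κ).filter (fun n => t < μ n), (y (rep n) - x) ≤ 0 := by
    by_contra! hcon
    have h3 : ∑ t ∈ Finset.range S.card,
        ∑ n ∈ (S.image κ).filter (fun n => t < μ n), (y (rep n) - x) =
        ∑ n ∈ S.image κ, (μ n : ℝ) * (y (rep n) - x) := by
      simp_rw [Finset.sum_filter]
      rw [Finset.sum_comm]
      refine Finset.sum_congr rfl fun n _ => ?_
      rw [← Finset.sum_filter, Finset.sum_const, nsmul_eq_mul]
      congr 2
      have h4 : (Finset.range S.card).filter (fun t => t < μ n) = Finset.range (μ n) := by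
        ext t
        have : μ n ≤ S.card := Finset.card_filter_le _ _
        simp only [Finset.mem_filter, Finset.mem_range]
        omega
      rw [h4, Finset.card_range]
    rw [← h3] at h1
    refine absurd h1 (not_le.2 (Finset.sum_pos' (fun t ht => ?_) ⟨0, ?_, ?_⟩))
    · rcases Finset.eq_empty_or_nonempty ((S.image κ).filter fun n => t < μ n) with h5 | h5
      · rw [h5, Finset.sum_empty]
      · exact (hcon t ht h5).le
    · exact Finset.mem_range.2 (Finset.card_pos.2 hS)
    · refine hcon 0 (Finset.mem_range.2 (Finset.card_pos.2 hS)) ?_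
      obtain ⟨f, hf⟩ := hS
      exact ⟨κ f, Finset.mem_filter.2 ⟨hmaps f hf, hμpos _ (hmaps f hf)⟩⟩
  obtain ⟨t, -, hne, hle⟩ := h2
  have hinj : Set.InjOn rep ((S.image κ).filter fun n => t < μ n) := by
    intro a ha b hb hab
    rw [Finset.mem_coe, Finset.mem_filter] at ha hb
    rw [← hrepκ a ha.1, ← hrepκ b hb.1, hab]
  refine ⟨((S.image κ).filter fun n => t < μ n).image rep, ?_, hne.image _, ?_, ?_, ?_⟩
  · intro f hf
    obtain ⟨n, hn, rfl⟩ := Finset.mem_image.1 hf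
    exact hrepS n (Finset.mem_filter.1 hn).1
  · intro a ha b hb hab
    obtain ⟨n, hn, rfl⟩ := Finset.mem_image.1 ha
    obtain ⟨n', hn', rfl⟩ := Finset.mem_image.1 hb
    rw [hrepκ n (Finset.mem_filter.1 hn).1, hrepκ n' (Finset.mem_filter.1 hn').1] at hab
    rw [hab]
  · intro i hi g hg hgi
    obtain ⟨n, hn, rfl⟩ := Finset.mem_image.1 hi
    rw [Finset.mem_filter] at hn
    refine ⟨rep (κ g), Finset.mem_image_of_mem _ (Finset.mem_filter.2 ⟨hmaps g hg, ?_⟩),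
      hrepκ _ (hmaps g hg)⟩
    refine hn.2.trans_le ?_
    have h3 := hκ g (rep n) hgi
    rwa [hrepκ n hn.1] at h3
  · rw [Finset.sum_image hinj, Finset.card_image_of_injOn hinj]
    rw [Finset.sum_sub_distrib, Finset.sum_const, nsmul_eq_mul] at hle
    linarith [mul_comm x (((S.image κ).filter fun n => t < μ n).card : ℝ)]

variable {V E F : Type*}

/-- The `j`-th edge of the boundary of `f` is, up to inversion, also the `j'`-th edge of the
boundary of a face `g` in `S` with `(κ g, j')` before `(κ f, j)`. -/
def OccursEarlier {K : Type*} [LinearOrder K] (Y : TwoComplex V E F) (S : Finset F) (κ : F → K)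
    (f : F) (j : ℕ) : Prop :=
  ∃ g ∈ S, ∃ (j' : ℕ) (e e' : E), (κ g < κ f ∨ κ g = κ f ∧ j' < j) ∧
    (Y.bdry f)[j]? = some e ∧ (Y.bdry g)[j']? = some e' ∧ (e' = e ∨ e' = Y.inv e)

open Classical in
/-- The positions on the boundary of `f` whose edge does not occur earlier. -/
noncomputable def freePositions {K : Type*} [LinearOrder K] (Y : TwoComplex V E F) (S : Finset F)
    (κ : F → K) (f : F) : Finset ℕ :=
  (Finset.range (Y.bdry f).length).filter fun j => ¬ OccursEarlier Y S κ f j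

theorem edgeLabel_inv_eq {Y : TwoComplex V E F} {m : ℕ} {R : Set (RelWord m)}
    (φ : VanKampenLabeling Y R) (e : E) : φ.edgeLabel (Y.inv e) = letterInv (φ.edgeLabel e) :=
  φ.edgeLabel_inv e

theorem faceLabel_getElem? {Y : TwoComplex V E F} {m : ℕ} {R : Set (RelWord m)}
    (φ : VanKampenLabeling Y R) (f : F) (j : ℕ) :
    (φ.faceLabel f)[j]? = (Y.bdry f)[j]?.map φ.edgeLabel := by
  rw [← φ.map_bdry, List.getElem?_map]

/-- In a reduced van Kampen 2-complex, every geometric edge is at most once at a free position. -/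
theorem two_mul_sum_card_freePositions_le {K : Type*} [LinearOrder K] (Y : TwoComplex V E F)
    {m : ℕ} {R : Set (RelWord m)} (φ : VanKampenLabeling Y R) (hφ : φ.IsReduced) (S : Finset F)
    (κ : F → K) (hκ : ∀ f ∈ S, ∀ g ∈ S, κ f = κ g → φ.faceLabel f = φ.faceLabel g)
    (D : Set E) (hD : D.Finite) (hDinv : ∀ e ∈ D, Y.inv e ∈ D)
    (hDS : ∀ f ∈ S, ∀ e ∈ Y.bdry f, e ∈ D) :
    2 * ∑ f ∈ S, (freePositions Y S κ f).card ≤ D.ncard := by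
  classical
  let P : Finset (Σ _ : F, ℕ) := S.sigma fun f => freePositions Y S κ f
  have hP : ∀ p ∈ P, p.1 ∈ S ∧ ¬ OccursEarlier Y S κ p.1 p.2 ∧
      ∃ e, (Y.bdry p.1)[p.2]? = some e := by
    intro p hp
    have h1 := Finset.mem_sigma.1 hp
    have h2 := Finset.mem_filter.1 h1.2
    exact ⟨h1.1, h2.2, _, List.getElem?_eq_getElem (Finset.mem_range.1 h2.1)⟩
  have hcardP : P.card = ∑ f ∈ S, (freePositions Y S κ f).card := Finset.card_sigma _ _
  -- Neither of two free positions with the same geometric edge precedes the other, so labels and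
  -- positions coincide. With equal orientation, different faces would be a reducible pair; with
  -- opposite orientation, a letter would be its own inverse.
  have hkey : ∀ p ∈ P, ∀ p' ∈ P, ∀ e e', (Y.bdry p.1)[p.2]? = some e →
      (Y.bdry p'.1)[p'.2]? = some e' → (e' = e ∨ e' = Y.inv e) → p = p' ∧ e = e' := by
    intro p hp p' hp' e e' he he' hee
    obtain ⟨hS, hO, -⟩ := hP p hp
    obtain ⟨hS', hO', -⟩ := hP p' hp'
    have h1 : ¬ (κ p'.1 < κ p.1 ∨ κ p'.1 = κ p.1 ∧ p'.2 < p.2) := fun h =>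
      hO ⟨p'.1, hS', p'.2, e, e', h, he, he', hee⟩
    have h2 : ¬ (κ p.1 < κ p'.1 ∨ κ p.1 = κ p'.1 ∧ p.2 < p'.2) := fun h =>
      hO' ⟨p.1, hS, p.2, e', e, h, he', he, by
        rcases hee with h | h
        · exact Or.inl h.symm
        · exact Or.inr (by rw [h, Y.inv_inv])⟩
    push Not at h1 h2
    have h3 : κ p.1 = κ p'.1 := le_antisymm h1.1 h2.1
    have h4 : p.2 = p'.2 := le_antisymm (h1.2 h3.symm) (h2.2 h3)
    have h5 := hκ _ hS _ hS' h3
    rcases hee with rfl | h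
    · refine ⟨?_, rfl⟩
      by_contra hne
      refine hφ p.1 p'.1 (fun h => hne (Sigma.ext h (heq_of_eq h4))) h5 ⟨p.2, e', he, ?_⟩
      rw [h4, he']
    · exfalso
      have h6 := faceLabel_getElem? φ p.1 p.2
      have h7 := faceLabel_getElem? φ p'.1 p'.2
      rw [he, Option.map_some] at h6
      rw [he', Option.map_some, ← h4, ← h5, h6, h, edgeLabel_inv_eq] at h7
      exact letterInv_ne _ (Option.some.inj h7).symm
  have hedge : ∀ p : Σ _ : F, ℕ, ∃ e, p ∈ P → (Y.bdry p.1)[p.2]? = some e := by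
    intro p
    by_cases hp : p ∈ P
    · obtain ⟨-, -, e, he⟩ := hP p hp
      exact ⟨e, fun _ => he⟩
    · obtain ⟨e, -⟩ := List.exists_mem_of_ne_nil _ (Y.bdry_ne_nil p.1)
      exact ⟨e, fun h => absurd h hp⟩
  choose edge hedge using hedge
  -- Both orientations are recorded, since `D` consists of oriented edges; this is the factor 2.
  let Φ : (Σ _ : F, ℕ) × Bool → E := fun x => if x.2 then edge x.1 else Y.inv (edge x.1)
  have h1 : (P ×ˢ (Finset.univ : Finset Bool)).card ≤ D.ncard := by
    rw [← Set.ncard_coe_finset]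
    refine Set.ncard_le_ncard_of_injOn Φ ?_ ?_ hD
    · rintro ⟨p, b⟩ hp
      have hp1 : p ∈ P := (Finset.mem_product.1 hp).1
      have h2 : edge p ∈ D := hDS p.1 (hP p hp1).1 _ (List.mem_of_getElem? (hedge p hp1))
      cases b
      · exact hDinv _ h2
      · exact h2
    · rintro ⟨p, b⟩ hp ⟨p', b'⟩ hp' h
      have hp1 : p ∈ P := (Finset.mem_product.1 hp).1
      have hp1' : p' ∈ P := (Finset.mem_product.1 hp').1
      have h2 := hkey p hp1 p' hp1' _ _ (hedge p hp1) (hedge p' hp1')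
      have h3 : edge p' = edge p ∨ edge p' = Y.inv (edge p) := by
        cases b <;> cases b' <;> simp only [Φ, if_true, Bool.false_eq_true, if_false] at h
        · left; rw [← Y.inv_inv (edge p'), ← h, Y.inv_inv]
        · right; exact h.symm
        · right; rw [h, Y.inv_inv]
        · left; exact h.symm
      obtain ⟨rfl, h4⟩ := h2 h3
      refine Prod.ext rfl ?_
      cases b <;> cases b' <;> simp only [Φ, if_true, Bool.false_eq_true, if_false] at h ⊢
      · exact absurd h (Y.inv_ne _)
      · exact absurd h.symm (Y.inv_ne _)
  rw [Finset.card_product, hcardP, Finset.card_univ, Fintype.card_bool] at h1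
  linarith

end Upper

/-! ### The first moment bound for fillability. -/

section Upper

variable {V E F : Type*}

theorem length_faceLabel {Y : TwoComplex V E F} {m : ℕ} {R : Set (RelWord m)}
    (φ : VanKampenLabeling Y R) (f : F) : (φ.faceLabel f).length = (Y.bdry f).length := by
  rw [← φ.map_bdry, List.length_map]

/-- The reduced van Kampen 2-complexes for which the faces in `S` are labeled by elements of the
ball, and for which `κ` distinguishes the labels of these faces. -/
def labelingsOfType {K : Type*} (Y : TwoComplex V E F) (m ℓ : ℕ) (S : Finset F) (κ : F → K) :
    Set (VanKampenLabeling Y (relBall m ℓ)) :=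
  {φ | φ.IsReduced ∧ (∀ f ∈ S, φ.faceLabel f ∈ relBall m ℓ) ∧
    ∀ f ∈ S, ∀ g ∈ S, κ f = κ g ↔ φ.faceLabel f = φ.faceLabel g}

/-- For fixed pattern `κ` of equal labels, the relators on a suitable initial segment of k label
classes are determined by at most xk free letters and k initial letters. Forgetting the other
relators loses nothing, because every filling of this pattern needs one of these k-sets. -/
theorem exists_relator_family (Y : TwoComplex V E F) {m ℓ M : ℕ} (hm : 2 ≤ m)
    (S : Finset F) (hS : S.Nonempty) (κ : F → Fin M)
    (hκ : ∀ f g, κ f ≤ κ g →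
      (S.filter fun h => κ h = κ g).card ≤ (S.filter fun h => κ h = κ f).card)
    (D : Set E) (hD : D.Finite) (hDinv : ∀ e ∈ D, Y.inv e ∈ D)
    (hDS : ∀ f ∈ S, ∀ e ∈ Y.bdry f, e ∈ D) (x : ℝ) (hx : (D.ncard : ℝ) ≤ 2 * (x * S.card)) :
    ∃ (k : ℕ) (𝒯 : Finset (Finset (relBall m ℓ))), 1 ≤ k ∧ (∀ T ∈ 𝒯, T.card = k) ∧
      (𝒯.card : ℝ) ≤ ((2 * m + 1) * ((2 * m - 1 : ℕ) : ℝ) ^ x) ^ k ∧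
      ∀ φ ∈ labelingsOfType Y m ℓ S κ, ∃ T ∈ 𝒯, ∀ w ∈ T, ∃ f ∈ S, w.1 = φ.faceLabel f := by
  classical
  have := (relBall_finite m ℓ).fintype
  -- One reduced filling of the given type is needed to bound the free positions, which depend only
  -- on `Y`, `S` and `κ`; without any, the empty family works.
  rcases Set.eq_empty_or_nonempty (labelingsOfType Y m ℓ S κ) with hL | ⟨φ₀, hφ₀⟩
  · refine ⟨1, ∅, le_rfl, by simp, by simp; positivity, ?_⟩
    intro φ hφ
    rw [hL] at hφ
    exact hφ.elim
  have hsum := two_mul_sum_card_freePositions_le Y φ₀ hφ₀.1 S κ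
    (fun f hf g hg h => (hφ₀.2.2 f hf g hg).1 h) D hD hDinv hDS
  obtain ⟨I, hIS, hI, hκI, hIinit, hIsum⟩ := exists_initial_segment S hS κ
    (fun f => ((freePositions Y S κ f).card : ℝ)) x (by
      have h1 : (2 * ∑ f ∈ S, ((freePositions Y S κ f).card : ℝ)) ≤ D.ncard := by
        exact_mod_cast hsum
      linarith) hκ
  let 𝓡 : Set (I → RelWord m) :=
    {r | ∃ φ ∈ labelingsOfType Y m ℓ S κ, ∀ i : I, r i = φ.faceLabel i}
  have h𝓡mem : ∀ r ∈ 𝓡, ∀ i, r i ∈ relBall m ℓ := by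
    rintro r ⟨φ, hφ, hr⟩ i
    rw [hr]
    exact hφ.2.1 _ (hIS i.2)
  have h𝓡fin : 𝓡.Finite :=
    (Set.Finite.pi' fun _ : I => relBall_finite m ℓ).subset fun r hr => h𝓡mem r hr
  let free : Finset (I × ℕ) :=
    ((Finset.univ : Finset I).sigma fun i => freePositions Y S κ i).image fun p => (p.1, p.2)
  have hfree : (free.card : ℝ) ≤ x * I.card := by
    refine le_trans ?_ hIsum
    rw [← Finset.sum_coe_sort]
    exact_mod_cast Finset.card_image_le.trans (Finset.card_sigma _ _).le
  have hcount : 𝓡.ncard ≤ (2 * m + 1) ^ Fintype.card I * (2 * m - 1) ^ free.card := by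
    refine ncard_reduced_tuples_le (⟨0, by omega⟩, true) (fun i : I => (Y.bdry i).length)
      (fun i : I => (κ i : ℕ)) free 𝓡 ?_ ?_ ?_
    · rintro r ⟨φ, -, hr⟩ i
      rw [hr, length_faceLabel]
    · intro r hr i
      exact (h𝓡mem r hr i).1.1
    · intro i j hj hfr
      have hocc : OccursEarlier Y S κ i j := by
        by_contra h
        refine hfr (Finset.mem_image.2 ⟨⟨i, j⟩, Finset.mem_sigma.2 ⟨Finset.mem_univ _, ?_⟩, rfl⟩)
        exact Finset.mem_filter.2 ⟨Finset.mem_range.2 hj, h⟩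
      obtain ⟨g, hg, j', e, e', hlt, he, he', hee⟩ := hocc
      have hle : κ g ≤ κ i := by
        rcases hlt with h | h
        exacts [h.le, h.1.le]
      obtain ⟨i', hi', hi'g⟩ := hIinit i i.2 g hg hle
      -- The earlier occurrence may lie on a face g outside I; it is moved to the representative i'
      -- of the class of g, which has the same label.
      refine ⟨⟨i', hi'⟩, j', ?_, ?_⟩
      · rcases hlt with h | ⟨h, h'⟩
        · left
          show κ i' < κ i
          rw [hi'g]
          exact h
        · exact Or.inr ⟨Subtype.ext (hκI hi' i.2 (hi'g.trans h)), h'⟩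
      · rintro r ⟨φ, hφ, hr⟩ s ⟨ψ, hψ, hs⟩ hrs
        have hlab : ∀ χ ∈ labelingsOfType Y m ℓ S κ,
            (χ.faceLabel i')[j']? = some (χ.edgeLabel e') := by
          intro χ hχ
          rw [(hχ.2.2 i' (hIS hi') g hg).1 hi'g, faceLabel_getElem?, he', Option.map_some]
        rw [hr, hs, hlab φ hφ, hlab ψ hψ] at hrs
        have h1 := Option.some.inj hrs
        rw [hr, hs, faceLabel_getElem?, faceLabel_getElem?, he, Option.map_some, Option.map_some]
        rcases hee with rfl | rfl
        · rw [h1]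
        · rw [edgeLabel_inv_eq, edgeLabel_inv_eq] at h1
          rw [← letterInv_letterInv (φ.edgeLabel e), h1, letterInv_letterInv]
  let 𝒯 : Finset (Finset (relBall m ℓ)) :=
    Finset.univ.filter fun T => ∃ r ∈ 𝓡, ∀ w, w ∈ T ↔ ∃ i, w.1 = r i
  have h𝒯 : ∀ T ∈ 𝒯, ∃ r ∈ 𝓡, ∀ w, w ∈ T ↔ ∃ i, w.1 = r i := fun T hT =>
    (Finset.mem_filter.1 hT).2
  refine ⟨I.card, 𝒯, Finset.card_pos.2 hI, ?_, ?_, ?_⟩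
  · intro T hT
    obtain ⟨r, hr, hTr⟩ := h𝒯 T hT
    have h1 : T = Finset.univ.image fun i : I => (⟨r i, h𝓡mem r hr i⟩ : relBall m ℓ) := by
      ext w
      simp only [hTr, Finset.mem_image, Finset.mem_univ, true_and, Subtype.ext_iff, eq_comm]
    rw [h1, Finset.card_image_of_injective, Finset.card_univ, Fintype.card_coe]
    intro i i' h
    obtain ⟨φ, hφ, hrφ⟩ := hr
    have h2 : r i = r i' := congrArg Subtype.val h
    rw [hrφ, hrφ] at h2
    exact Subtype.ext (hκI i.2 i'.2 ((hφ.2.2 _ (hIS i.2) _ (hIS i'.2)).2 h2))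
  · have h1 : 𝒯.card ≤ 𝓡.ncard := by
      choose! ρ hρ hρT using h𝒯
      rw [← Set.ncard_coe_finset]
      refine Set.ncard_le_ncard_of_injOn ρ hρ ?_ h𝓡fin
      intro T hT T' hT' h
      ext w
      rw [hρT T hT, hρT T' hT', h]
    have h2 : (1 : ℝ) ≤ ((2 * m - 1 : ℕ) : ℝ) := by exact_mod_cast (by omega)
    calc (𝒯.card : ℝ) ≤ (𝓡.ncard : ℝ) := by exact_mod_cast h1
      _ ≤ (2 * m + 1) ^ I.card * ((2 * m - 1 : ℕ) : ℝ) ^ free.card := by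
        rw [Fintype.card_coe] at hcount
        exact_mod_cast hcount
      _ ≤ (2 * m + 1) ^ I.card * ((2 * m - 1 : ℕ) : ℝ) ^ (x * I.card) := by
        refine mul_le_mul_of_nonneg_left ?_ (by positivity)
        rw [← Real.rpow_natCast]
        exact Real.rpow_le_rpow_of_exponent_le h2 hfree
      _ = _ := by
        rw [mul_pow, Real.rpow_mul (by positivity), Real.rpow_natCast]
  · intro φ hφ
    let r : I → RelWord m := fun i => φ.faceLabel i
    have hr : r ∈ 𝓡 := ⟨φ, hφ, fun i => rfl⟩
    refine ⟨Finset.univ.filter fun w => ∃ i, w.1 = r i, ?_, ?_⟩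
    · exact Finset.mem_filter.2 ⟨Finset.mem_univ _, r, hr, by simp⟩
    · intro w hw
      obtain ⟨i, hi⟩ := (Finset.mem_filter.1 hw).2
      exact ⟨i, hIS i.2, hi⟩

/-- A van Kampen 2-complex stays one if the set of relators is enlarged. -/
def VanKampenLabeling.mono {Y : TwoComplex V E F} {m : ℕ} {R R' : Set (RelWord m)}
    (φ : VanKampenLabeling Y R) (h : R ⊆ R') : VanKampenLabeling Y R' where
  edgeLabel := φ.edgeLabel
  faceLabel := φ.faceLabel
  edgeLabel_inv := φ.edgeLabel_inv
  faceLabel_mem := fun f => (φ.faceLabel_mem f).imp (@h _) (@h _)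
  faceLabel_finv := φ.faceLabel_finv
  map_bdry := φ.map_bdry

/-- The proportion of the `r`-subsets of the ball by which `Y` is fillable is small if there is a
set of faces with few edges. -/
theorem ncard_fillable_le [Fintype F] (Y : TwoComplex V E F) {m ℓ : ℕ} (hm : 2 ≤ m)
    [Fintype (relBall m ℓ)]
    (A : Finset F) (hA : A.Nonempty) (hAinv : ∀ f ∈ A, Y.finv f ∈ A)
    (D : Set E) (hD : D.Finite) (hDinv : ∀ e ∈ D, Y.inv e ∈ D)
    (hDA : ∀ f ∈ A, ∀ e ∈ Y.bdry f, e ∈ D) (x : ℝ) (hx0 : 0 ≤ x) (hx : (D.ncard : ℝ) ≤ x * A.card)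
    {r : ℕ} (hr : r ≤ Fintype.card (relBall m ℓ))
    (hz : (2 * m + 1) * ((2 * m - 1 : ℕ) : ℝ) ^ x * (r / Fintype.card (relBall m ℓ)) ≤ 1) :
    (Set.ncard {S : Finset (relBall m ℓ) |
      S.card = r ∧ Fillable Y (relators (S : Set (relBall m ℓ)))} : ℝ) ≤
      Nat.card (Finset F × (F → Fin (Fintype.card F * (Fintype.card F + 1)))) *
        ((2 * m + 1) * ((2 * m - 1 : ℕ) : ℝ) ^ x * (r / Fintype.card (relBall m ℓ))) *
        (Fintype.card (relBall m ℓ)).choose r := by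
  classical
  set n := Fintype.card (relBall m ℓ) with hn
  set z := (2 * m + 1) * ((2 * m - 1 : ℕ) : ℝ) ^ x * (r / n) with hzdef
  have hz0 : 0 ≤ z := by positivity
  let Typ := Finset F × (F → Fin (Fintype.card F * (Fintype.card F + 1)))
  have hfam : ∀ τ : Typ, ∃ (k : ℕ) (𝒯 : Finset (Finset (relBall m ℓ))), 1 ≤ k ∧
      (∀ T ∈ 𝒯, T.card = k) ∧
      (𝒯.card : ℝ) ≤ ((2 * m + 1) * ((2 * m - 1 : ℕ) : ℝ) ^ x) ^ k ∧
      (τ.1.Nonempty → τ.1 ⊆ A → A.card ≤ 2 * τ.1.card →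
        (∀ f g, τ.2 f ≤ τ.2 g → (τ.1.filter fun h => τ.2 h = τ.2 g).card ≤
          (τ.1.filter fun h => τ.2 h = τ.2 f).card) →
        ∀ φ ∈ labelingsOfType Y m ℓ τ.1 τ.2, ∃ T ∈ 𝒯, ∀ w ∈ T, ∃ f ∈ τ.1,
          w.1 = φ.faceLabel f) := by
    intro τ
    by_cases h : τ.1.Nonempty ∧ τ.1 ⊆ A ∧ A.card ≤ 2 * τ.1.card ∧
        (∀ f g, τ.2 f ≤ τ.2 g → (τ.1.filter fun h => τ.2 h = τ.2 g).card ≤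
          (τ.1.filter fun h => τ.2 h = τ.2 f).card)
    · obtain ⟨h1, h2, h3, h4⟩ := h
      have h3' : (A.card : ℝ) ≤ 2 * τ.1.card := by exact_mod_cast h3
      obtain ⟨k, 𝒯, hk, hT, hc, hφ⟩ := exists_relator_family (ℓ := ℓ) Y hm τ.1 h1 τ.2 h4 D hD hDinv
        (fun f hf => hDA f (h2 hf)) x (by nlinarith)
      exact ⟨k, 𝒯, hk, hT, hc, fun _ _ _ _ => hφ⟩
    · refine ⟨1, ∅, le_rfl, by simp, by simp; positivity, fun h1 h2 h3 h4 => ?_⟩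
      exact absurd ⟨h1, h2, h3, h4⟩ h
  choose k 𝒯 hk hT hc hφ using hfam
  have hsub : {S : Finset (relBall m ℓ) |
      S.card = r ∧ Fillable Y (relators (S : Set (relBall m ℓ)))} ⊆
      {S | S.card = r ∧ ∃ p ∈ (Finset.univ : Finset Typ).sigma 𝒯, p.2 ⊆ S} := by
    rintro S ⟨hS, φ, hred⟩
    refine ⟨hS, ?_⟩
    have hball : relators (S : Set (relBall m ℓ)) ⊆ relBall m ℓ := by
      rintro _ ⟨w, -, rfl⟩
      exact w.2
    -- The faces labeled by a relator itself and not merely by the inverse of one. Face inversion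
    -- maps the others into these, so they make up at least half of `A`.
    let A' : Finset F := A.filter fun f => φ.faceLabel f ∈ relators (S : Set (relBall m ℓ))
    have hA' : A.card ≤ 2 * A'.card := by
      have h1 : (A \ A').card ≤ A'.card := by
        refine Finset.card_le_card_of_injOn Y.finv ?_ ?_
        · intro f hf
          rw [Finset.mem_coe, Finset.mem_sdiff] at hf
          refine Finset.mem_filter.2 ⟨hAinv f hf.1, ?_⟩
          rw [φ.faceLabel_finv]
          exact (φ.faceLabel_mem f).resolve_left fun h => hf.2 (Finset.mem_filter.2 ⟨hf.1, h⟩)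
        · intro f _ g _ h
          rw [← Y.finv_finv f, h, Y.finv_finv]
      have h2 : (A \ A').card + A'.card = A.card :=
        Finset.card_sdiff_add_card_eq_card (Finset.filter_subset _ A)
      omega
    obtain ⟨κ, hκ, hκμ⟩ := exists_numbering φ.faceLabel A'
    have hne : A'.Nonempty := by
      rw [← Finset.card_pos]
      have := Finset.card_pos.2 hA
      omega
    obtain ⟨T, hT1, hT2⟩ := hφ (A', κ) hne (Finset.filter_subset _ _) hA' hκμ (φ.mono hball)
      ⟨hred, fun f hf => hball (Finset.mem_filter.1 hf).2, fun f _ g _ => hκ f g⟩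
    refine ⟨⟨(A', κ), T⟩, Finset.mem_sigma.2 ⟨Finset.mem_univ _, hT1⟩, ?_⟩
    intro w hw
    obtain ⟨f, hf, hwf⟩ := hT2 w hw
    obtain ⟨w', hw', hw'f⟩ := (Finset.mem_filter.1 hf).2
    have : w = w' := Subtype.ext (hwf.trans hw'f.symm)
    rw [this]
    exact hw'
  refine le_trans (Nat.cast_le.2 (Set.ncard_le_ncard hsub (Set.toFinite _)))
    ((card_exists_superset_le hr _ _).trans ?_)
  refine mul_le_mul_of_nonneg_right ?_ (Nat.cast_nonneg _)
  have hcard : (Nat.card Typ : ℝ) * z = ∑ _τ : Typ, z := by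
    rw [Finset.sum_const, Finset.card_univ, nsmul_eq_mul, Nat.card_eq_fintype_card]
  refine le_of_le_of_eq ?_ hcard.symm
  rw [Finset.sum_sigma]
  refine Finset.sum_le_sum fun τ _ => ?_
  calc _ = ((𝒯 τ).card : ℝ) * ((r : ℝ) / n) ^ k τ := by
        rw [← nsmul_eq_mul, ← Finset.sum_const]
        exact Finset.sum_congr rfl fun T h => by rw [hT τ T h]
    _ ≤ ((2 * m + 1) * ((2 * m - 1 : ℕ) : ℝ) ^ x) ^ k τ * ((r : ℝ) / n) ^ k τ :=
        mul_le_mul_of_nonneg_right (hc τ) (by positivity)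
    _ = z ^ k τ := by rw [hzdef, ← mul_pow]
    -- The size k depends on the type, but z ≤ 1 and k ≥ 1 give a bound common to all types.
    _ ≤ z := pow_le_of_le_one hz0 hz (by have := hk τ; omega)

end Upper

/-! ### Edge words with distinguishing prefixes and free letters. -/

section WordFamilies

variable {m : ℕ}

theorem isCyclicallyReduced_invRev {w : RelWord m} (h : FreeGroup.IsCyclicallyReduced w) :
    FreeGroup.IsCyclicallyReduced (FreeGroup.invRev w) := by
  rw [isCyclicallyReduced_iff_append_self] at *
  rw [← FreeGroup.invRev_append]
  exact isReduced_invRev h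

theorem getLast?_eq_head?_invRev (w : RelWord m) :
    w.getLast? = (FreeGroup.invRev w).head?.map letterInv := by
  rw [FreeGroup.invRev, List.head?_reverse, List.getLast?_map, Option.map_map]
  cases w.getLast? <;> simp [letterInv]

/-- A reduced word that starts with `A`, ends with `B`, and has freely chosen letters between. -/
noncomputable def joinWord (hm : 2 ≤ m) (A B : RelWord m) (hA : A ≠ []) (hB : B ≠ [])
    (cs : List (Fin (2 * m - 1))) : RelWord m :=
  A ++ (fillWord hm (A.getLast hA) cs (B.head hB) ++ B)

theorem length_joinWord (hm : 2 ≤ m) (A B : RelWord m) (hA : A ≠ []) (hB : B ≠ [])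
    (cs : List (Fin (2 * m - 1))) :
    (joinWord hm A B hA hB cs).length = A.length + B.length + 1 + cs.length := by
  simp only [joinWord, List.length_append, length_fillWord]
  omega

theorem joinWord_injective (hm : 2 ≤ m) (A B : RelWord m) (hA : A ≠ []) (hB : B ≠ []) :
    Function.Injective (joinWord hm A B hA hB) := by
  intro cs ds h
  have h1 := List.append_cancel_left h
  exact fillWord_injective hm _ _ (List.append_cancel_right h1)

theorem isReduced_joinWord (hm : 2 ≤ m) (A B : RelWord m) (hA : A ≠ []) (hB : B ≠ [])
    (hAr : FreeGroup.IsReduced A) (hBr : FreeGroup.IsReduced B) (cs : List (Fin (2 * m - 1))) :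
    FreeGroup.IsReduced (joinWord hm A B hA hB cs) := by
  have h := isReduced_fillWord hm (A.getLast hA) (B.head hB) cs
  unfold joinWord
  generalize fillWord hm (A.getLast hA) cs (B.head hB) = w at *
  have hA' := List.dropLast_append_getLast hA
  have hB' := List.cons_head_tail hB
  generalize A.getLast hA = a at *
  generalize B.head hB = b at *
  rw [← hA'] at hAr ⊢
  rw [← hB'] at hBr ⊢
  unfold FreeGroup.IsReduced at *
  rw [List.append_assoc, List.singleton_append]
  refine List.isChain_split.2 ⟨hAr, ?_⟩
  rw [← List.cons_append]
  exact List.isChain_split.2 ⟨by simpa using h, hBr⟩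

/-- There are reduced words of a fixed length with given first letters that are pairwise
different. -/
theorem exists_distinct_prefixes (hm : 2 ≤ m) {E : Type*} [Fintype E] (s : E → Fin m × Bool) :
    ∃ u : E → RelWord m, Function.Injective u ∧ ∀ e, (u e).length = Fintype.card E + 1 ∧
      FreeGroup.IsReduced (u e) ∧ (u e).head? = some (s e) := by
  let idx : E ≃ Fin (Fintype.card E) := Fintype.equivFin E
  have hx : ∀ a : Fin m × Bool, ∃ x, x ≠ letterInv a ∧ x ≠ a := by
    intro a
    obtain ⟨x, h1, h2⟩ := exists_bridge hm a (letterInv a)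
    exact ⟨x, h1, fun h => h2 (by rw [h])⟩
  choose x hx1 hx2 using hx
  -- The length of the initial block of `s e` identifies e among the edges with the same first
  -- letter.
  let u : E → RelWord m := fun e => List.replicate (idx e + 1) (s e) ++
    List.replicate (Fintype.card E - idx e) (x (s e))
  have hlt : ∀ e e', idx e < idx e' → u e ≠ u e' := by
    intro e e' h heq
    have h0 : (u e)[0]? = (u e')[0]? := by rw [heq]
    have h1 : (u e)[(idx e : ℕ) + 1]? = (u e')[(idx e : ℕ) + 1]? := by rw [heq]
    have h2 : (idx e : ℕ) < idx e' := h
    have h3 := (idx e').2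
    simp only [u] at h0 h1
    rw [List.getElem?_append_left (by simp), List.getElem?_append_left (by simp),
      List.getElem?_replicate, List.getElem?_replicate, if_pos (by omega), if_pos (by omega)] at h0
    rw [List.getElem?_append_right (by simp), List.getElem?_append_left (by simpa using h2),
      List.getElem?_replicate, List.getElem?_replicate, List.length_replicate, if_pos (by omega),
      if_pos (by omega), ← Option.some.inj h0] at h1
    exact hx2 _ (Option.some.inj h1)
  refine ⟨u, ?_, fun e => ⟨?_, ?_, ?_⟩⟩
  · intro e e' h
    rcases lt_trichotomy (idx e) (idx e') with h1 | h1 | h1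
    · exact absurd h (hlt e e' h1)
    · exact idx.injective h1
    · exact absurd h.symm (hlt e' e h1)
  · have := (idx e).2
    simp only [u, List.length_append, List.length_replicate]
    omega
  · rw [isReduced_iff_isChain, List.isChain_append]
    refine ⟨List.isChain_replicate_of_rel _ (letterInv_ne _).symm,
      List.isChain_replicate_of_rel _ (letterInv_ne _).symm, ?_⟩
    intro a ha b hb
    rw [List.eq_of_mem_replicate (List.mem_of_getLast? ha),
      List.eq_of_mem_replicate (List.mem_of_head? hb)]
    exact hx1 _
  · simp [u, List.replicate_succ]

/-- The numbers of free letters: on one of the two orientations of an edge of length `n`, all but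
`2 * K + 1` letters are free. -/
noncomputable def numFree {E : Type*} (T : Set E) (K : ℕ) (n : E → ℕ) (e : E) : ℕ :=
  open Classical in if e ∈ T then n e - (2 * K + 1) else 0

/-- A set containing exactly one orientation of every edge or face. -/
theorem exists_transversal {E : Type*} [Finite E] (inv : E → E) (hinv : ∀ e, inv (inv e) = e)
    (hne : ∀ e, inv e ≠ e) : ∃ T : Set E, ∀ e, inv e ∈ T ↔ e ∉ T := by
  obtain ⟨N, ⟨idx⟩⟩ := Finite.exists_equiv_fin E
  refine ⟨{e | idx e < idx (inv e)}, fun e => ?_⟩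
  simp only [Set.mem_ofPred_eq, hinv, not_lt]
  exact ⟨le_of_lt, fun h => lt_of_le_of_ne h fun h' => hne e (idx.injective h')⟩

/-- Families of edge words with prescribed first letters and many free letters, such that words on
different oriented edges have different prefixes. -/
theorem exists_word_family (hm : 2 ≤ m) {E : Type*} [Fintype E] (inv : E → E)
    (hinv : ∀ e, inv (inv e) = e) (T : Set E) (hT : ∀ e, inv e ∈ T ↔ e ∉ T)
    (n : E → ℕ) (hninv : ∀ e, n (inv e) = n e)
    (hn : ∀ e, 2 * (Fintype.card E + 1) + 1 ≤ n e) (s : E → Fin m × Bool) :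
    ∃ wd : ((e : E) → Fin (numFree T (Fintype.card E + 1) n e) → Fin (2 * m - 1)) → E → RelWord m,
      ∀ t, (∀ e, (wd t e).length = n e) ∧ (∀ e, wd t (inv e) = FreeGroup.invRev (wd t e)) ∧
        (∀ e, FreeGroup.IsReduced (wd t e)) ∧ (∀ e, (wd t e).head? = some (s e)) ∧
        (∀ e e', (wd t e).take (Fintype.card E + 1) = (wd t e').take (Fintype.card E + 1) →
          e = e') ∧
        ∀ t' e, wd t e = wd t' e → t e = t' e := by
  classical
  obtain ⟨u, hu, hu'⟩ := exists_distinct_prefixes hm s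
  set K := Fintype.card E + 1 with hK
  have hne : ∀ e, u e ≠ [] := by
    intro e h
    have := (hu' e).1
    rw [h] at this
    simp [hK] at this
  have hne' : ∀ e, FreeGroup.invRev (u e) ≠ [] := by
    intro e h
    have := (hu' e).1
    rw [← FreeGroup.invRev_length, h] at this
    simp [hK] at this
  -- The tail is the inverted prefix of the opposite edge, so the inverse word begins with that
  -- prefix. The two prefixes and one bridge letter account for the 2K + 1 letters that are not
  -- free.
  let big : E → List (Fin (2 * m - 1)) → RelWord m := fun e =>
    joinWord hm (u e) (FreeGroup.invRev (u (inv e))) (hne e) (hne' _)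
  have hbig_len : ∀ e cs, (big e cs).length = 2 * K + 1 + cs.length := by
    intro e cs
    simp only [big, length_joinWord, FreeGroup.invRev_length, (hu' _).1]
    ring
  have hbig_take : ∀ e cs, (big e cs).take K = u e := by
    intro e cs
    simp only [big, joinWord]
    rw [List.take_append_of_le_length (by rw [(hu' e).1]), List.take_of_length_le]
    rw [(hu' e).1]
  have hbig_take' : ∀ e cs, (FreeGroup.invRev (big (inv e) cs)).take K = u e := by
    intro e cs
    simp only [big, joinWord, FreeGroup.invRev_append, FreeGroup.invRev_invRev, hinv,
      List.append_assoc]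
    rw [List.take_append_of_le_length (by rw [(hu' e).1]), List.take_of_length_le]
    rw [(hu' e).1]
  have hbig_red : ∀ e cs, FreeGroup.IsReduced (big e cs) := fun e cs =>
    isReduced_joinWord hm _ _ _ _ (hu' e).2.1 (isReduced_invRev (hu' _).2.1) cs
  let wd : ((e : E) → Fin (numFree T K n e) → Fin (2 * m - 1)) → E → RelWord m := fun t e =>
    if e ∈ T then big e (List.ofFn (t e)) else FreeGroup.invRev (big (inv e) (List.ofFn (t (inv e))))
  have hwd1 : ∀ t e, e ∈ T → wd t e = big e (List.ofFn (t e)) := fun t e h => if_pos h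
  have hwd2 : ∀ t e, e ∉ T → wd t e = FreeGroup.invRev (big (inv e) (List.ofFn (t (inv e)))) :=
    fun t e h => if_neg h
  have hlen1 : ∀ (t : (e : E) → Fin (numFree T K n e) → Fin (2 * m - 1)) (e : E), e ∈ T → (big e (List.ofFn (t e))).length = n e := by
    intro t e h
    rw [hbig_len, List.length_ofFn, numFree, if_pos h]
    have := hn e
    omega
  have htake : ∀ t e, (wd t e).take K = u e := by
    intro t e
    by_cases h : e ∈ T
    · rw [hwd1 t e h, hbig_take]
    · rw [hwd2 t e h, hbig_take']
  refine ⟨wd, fun t => ⟨fun e => ?_, fun e => ?_, fun e => ?_, fun e => ?_, fun e e' h => ?_,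
    fun t' e h => ?_⟩⟩
  · by_cases h : e ∈ T
    · rw [hwd1 t e h, hlen1 t e h]
    · rw [hwd2 t e h, FreeGroup.invRev_length, hlen1 t _ ((hT e).2 h), hninv]
  · by_cases h : e ∈ T
    · rw [hwd1 t e h, hwd2 t _ (fun h' => (hT e).1 h' h), hinv]
    · rw [hwd2 t e h, hwd1 t _ ((hT e).2 h), FreeGroup.invRev_invRev]
  · by_cases h : e ∈ T
    · rw [hwd1 t e h]
      exact hbig_red _ _
    · rw [hwd2 t e h]
      exact isReduced_invRev (hbig_red _ _)
  · rw [← (hu' e).2.2, ← htake t e, List.head?_take, if_neg (by omega)]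
  · rw [htake, htake] at h
    exact hu h
  · by_cases he : e ∈ T
    · rw [hwd1 t e he, hwd1 t' e he] at h
      exact List.ofFn_injective (joinWord_injective hm _ _ _ _ h)
    -- Outside the transversal there are no free letters, so there is nothing to recover.
    · have h0 : numFree T K n e = 0 := if_neg he
      funext i
      exact absurd i.2 (by omega)

/-- The edge words form a prefix code and can be decoded from the left. -/
theorem flatMap_injective_of_take_injective {E : Type*} (wd : E → RelWord m) (K : ℕ)
    (hK : ∀ e, K < (wd e).length) (hinj : ∀ e e', (wd e).take K = (wd e').take K → e = e')
    {l l' : List E} (h : l.flatMap wd = l'.flatMap wd) : l = l' := by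
  have hne : ∀ e (r : RelWord m), [] ≠ wd e ++ r := by
    intro e r h1
    have h2 := congrArg List.length h1
    have := hK e
    simp at h2
    omega
  induction l generalizing l' with
  | nil =>
    cases l' with
    | nil => rfl
    | cons b l' => exact absurd h (hne _ _)
  | cons a l ih =>
    cases l' with
    | nil => exact absurd h.symm (hne _ _)
    | cons b l' =>
      rw [List.flatMap_cons, List.flatMap_cons] at h
      have h1 : a = b := by
        refine hinj a b ?_
        have h2 := congrArg (List.take K) h
        rwa [List.take_append_of_le_length (hK a).le, List.take_append_of_le_length (hK b).le] at h2
      subst h1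
      rw [ih (List.append_cancel_left h)]

theorem eq_of_flatMap_eq {E : Type*} {wd wd' : E → RelWord m}
    (hlen : ∀ e, (wd e).length = (wd' e).length) {l : List E}
    (h : l.flatMap wd = l.flatMap wd') : ∀ e ∈ l, wd e = wd' e := by
  induction l with
  | nil => simp
  | cons a l ih =>
    rw [List.flatMap_cons, List.flatMap_cons] at h
    obtain ⟨h1, h2⟩ := List.append_inj h (hlen a)
    intro e he
    rcases List.mem_cons.1 he with rfl | he
    exacts [h1, ih h2 e he]

/-- Cancellation between consecutive edge words involves only their last and first letters. This is
why a filling may be altered freely in the interior of its edges. -/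
theorem isReduced_flatMap_congr {E : Type*} {wd wd' : E → RelWord m}
    (hne : ∀ e, wd e ≠ []) (hne' : ∀ e, wd' e ≠ []) (hred : ∀ e, FreeGroup.IsReduced (wd' e))
    (hhead : ∀ e, (wd e).head? = (wd' e).head?)
    (hlast : ∀ e, (wd e).getLast? = (wd' e).getLast?) {l : List E}
    (h : FreeGroup.IsReduced (l.flatMap wd)) : FreeGroup.IsReduced (l.flatMap wd') := by
  unfold FreeGroup.IsReduced at *
  rw [List.flatMap_def, List.isChain_flatten (by
    rw [List.mem_map]
    rintro ⟨e, -, he⟩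
    exact hne e he), List.isChain_map] at h
  rw [List.flatMap_def, List.isChain_flatten (by
    rw [List.mem_map]
    rintro ⟨e, -, he⟩
    exact hne' e he), List.isChain_map]
  refine ⟨?_, ?_⟩
  · intro w hw
    obtain ⟨e, -, rfl⟩ := List.mem_map.1 hw
    exact hred e
  · simpa only [hhead, hlast] using h.2

theorem flatMap_invRev {E : Type*} {wd : E → RelWord m} {inv : E → E}
    (hinv : ∀ e, wd (inv e) = FreeGroup.invRev (wd e)) (l : List E) :
    (l.map inv).reverse.flatMap wd = FreeGroup.invRev (l.flatMap wd) := by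
  induction l with
  | nil => rfl
  | cons a l ih =>
    rw [List.map_cons, List.reverse_cons, List.flatMap_append, ih, List.flatMap_singleton,
      List.flatMap_cons, FreeGroup.invRev_append, hinv]

end WordFamilies

/-! ### Labelings of a subdivision as words on the original edges. -/

section Subdivision

variable {V E F : Type*} {m : ℕ}

/-- The van Kampen 2-complex on a subdivision that is given by words on the edges of the original
2-complex. -/
def labelingOfWords (Y : TwoComplex V E F) {n : E → ℕ} (hinv : ∀ e, n (Y.inv e) = n e)
    (hn : ∀ e, 0 < n e) (R : Set (RelWord m)) (wd : E → RelWord m)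
    (hlen : ∀ e, (wd e).length = n e) (hwd : ∀ e, wd (Y.inv e) = FreeGroup.invRev (wd e))
    (hR : ∀ f, (Y.bdry f).flatMap wd ∈ R ∨ FreeGroup.invRev ((Y.bdry f).flatMap wd) ∈ R) :
    VanKampenLabeling (Y.subdivide n hinv hn) R where
  edgeLabel := fun p => (wd p.1.1)[p.1.2]'(by rw [hlen]; exact p.2)
  faceLabel := fun f => (Y.bdry f).flatMap wd
  edgeLabel_inv := by
    rintro ⟨⟨e, i⟩, hi⟩
    have hi' : i < n e := hi
    show (wd (Y.inv e))[n e - 1 - i]'_ = letterInv ((wd e)[i]'_)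
    simp only [hwd, FreeGroup.invRev, List.getElem_reverse, List.getElem_map, letterInv,
      List.length_map, hlen]
    have h1 : n e - 1 - (n e - 1 - i) = i := by omega
    simp only [h1]
  faceLabel_mem := hR
  faceLabel_finv := fun f => by
    show (Y.bdry (Y.finv f)).flatMap wd = _
    rw [Y.bdry_finv, flatMap_invRev hwd]
  map_bdry := fun f => by
    show ((Y.bdry f).flatMap (TwoComplex.arc n)).map _ = _
    rw [List.map_flatMap]
    congr 1
    funext e
    refine List.ext_getElem (by simp [TwoComplex.arc_length, hlen]) fun i h1 h2 => ?_
    simp [TwoComplex.arc]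

/-- The word on an edge of the original 2-complex. -/
def edgeWord {Y : TwoComplex V E F} {n : E → ℕ} {hinv : ∀ e, n (Y.inv e) = n e}
    {hn : ∀ e, 0 < n e} {R : Set (RelWord m)}
    (φ : VanKampenLabeling (Y.subdivide n hinv hn) R) (e : E) : RelWord m :=
  (TwoComplex.arc n e).map φ.edgeLabel

variable {Y : TwoComplex V E F} {n : E → ℕ} {hinv : ∀ e, n (Y.inv e) = n e}
    {hn : ∀ e, 0 < n e} {R : Set (RelWord m)}

theorem length_edgeWord (φ : VanKampenLabeling (Y.subdivide n hinv hn) R) (e : E) :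
    (edgeWord φ e).length = n e := by
  rw [edgeWord, List.length_map, TwoComplex.arc_length]

theorem edgeWord_inv (φ : VanKampenLabeling (Y.subdivide n hinv hn) R) (e : E) :
    edgeWord φ (Y.inv e) = FreeGroup.invRev (edgeWord φ e) := by
  rw [edgeWord, edgeWord, TwoComplex.arc_inv Y hinv, FreeGroup.invRev, List.map_reverse,
    List.map_map, List.map_map]
  congr 2
  funext p
  exact φ.edgeLabel_inv p

theorem faceLabel_eq_flatMap (φ : VanKampenLabeling (Y.subdivide n hinv hn) R) (f : F) :
    φ.faceLabel f = (Y.bdry f).flatMap (edgeWord φ) := by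
  rw [← φ.map_bdry]
  exact List.map_flatMap

end Subdivision

/-! ### The second moment bound for fillability. -/

section Lower

variable {V E F : Type*} {m ℓ : ℕ}

/-- Choices of `q`-ary digits at `ν e` places for every `e`. -/
abbrev DigitChoice (ν : E → ℕ) (q : ℕ) : Type _ := (e : E) → Fin (ν e) → Fin q

/-- If a subdivision is fillable by the ball, it has many fillings with different labels on
different faces, parametrized by the free letters. -/
theorem exists_label_family [Fintype E] (Y : TwoComplex V E F) {n : E → ℕ}
    (hinv : ∀ e, n (Y.inv e) = n e) (hn : ∀ e, 0 < n e) (hm : 2 ≤ m)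
    (hnE : ∀ e, 2 * (Fintype.card E + 1) + 1 ≤ n e)
    (hfill : Fillable (Y.subdivide n hinv hn) (relBall m ℓ))
    (A : Finset F) (hA : ∀ f, Y.finv f ∈ A ↔ f ∉ A) (T : Set E) (hT : ∀ e, Y.inv e ∈ T ↔ e ∉ T) :
    ∃ lab : DigitChoice (numFree T (Fintype.card E + 1) n) (2 * m - 1) → F → relBall m ℓ,
      (∀ t, Function.Injective (lab t)) ∧
      (∀ t R, (∀ f ∈ A, (lab t f).1 ∈ R) → Fillable (Y.subdivide n hinv hn) R) ∧
      ∀ t t' f, lab t f = lab t' f → ∀ e ∈ Y.bdry f, t e = t' e ∧ t (Y.inv e) = t' (Y.inv e) := by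
  obtain ⟨φ, hφ⟩ := hfill
  have hne0 : ∀ e, edgeWord φ e ≠ [] := by
    intro e h
    have h1 := length_edgeWord φ e
    have h2 := hn e
    rw [h] at h1
    simp at h1
    omega
  obtain ⟨wd, hwd⟩ := exists_word_family hm Y.inv Y.inv_inv T hT n hinv hnE
    (fun e => (edgeWord φ e).head (hne0 e))
  have hne : ∀ t e, wd t e ≠ [] := by
    intro t e h
    have h1 := (hwd t).1 e
    have h2 := hn e
    rw [h] at h1
    simp at h1
    omega
  have hhead : ∀ t e, (edgeWord φ e).head? = (wd t e).head? := fun t e => by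
    rw [(hwd t).2.2.2.1, List.head?_eq_some_head]
  -- Last letters are inverses of first letters on the opposite edge, so prescribing the first
  -- letters suffices.
  have hlast : ∀ t e, (edgeWord φ e).getLast? = (wd t e).getLast? := fun t e => by
    rw [getLast?_eq_head?_invRev, getLast?_eq_head?_invRev (wd t e), ← (hwd t).2.1,
      ← edgeWord_inv, hhead t]
  have hball : ∀ f, φ.faceLabel f ∈ relBall m ℓ := by
    intro f
    rcases φ.faceLabel_mem f with h | h
    · exact h
    · refine ⟨?_, ?_⟩
      · rw [← FreeGroup.invRev_invRev (L₁ := φ.faceLabel f)]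
        exact isCyclicallyReduced_invRev h.1
      · rw [← FreeGroup.invRev_length]
        exact h.2
  have hmem : ∀ t f, (Y.bdry f).flatMap (wd t) ∈ relBall m ℓ := by
    intro t f
    have h1 := hball f
    rw [faceLabel_eq_flatMap] at h1
    refine ⟨?_, ?_⟩
    · rw [isCyclicallyReduced_iff_append_self, ← List.flatMap_append]
      refine isReduced_flatMap_congr hne0 (hne t) (hwd t).2.2.1 (hhead t) (hlast t) ?_
      rw [List.flatMap_append, ← isCyclicallyReduced_iff_append_self]
      exact h1.1
    · refine le_of_eq_of_le ?_ h1.2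
      simp only [List.length_flatMap, length_edgeWord, (hwd t).1]
  -- Equal labels force equal boundaries by the prefix code. Two different faces with equal
  -- boundaries would be a reducible pair in the given filling `φ`.
  have hinj : ∀ t f g, (Y.bdry f).flatMap (wd t) = (Y.bdry g).flatMap (wd t) → f = g := by
    intro t f g h
    have h1 : Y.bdry f = Y.bdry g := by
      refine flatMap_injective_of_take_injective (wd t) (Fintype.card E + 1) (fun e => ?_)
        (hwd t).2.2.2.2.1 h
      rw [(hwd t).1]
      have := hnE e
      omega
    have h2 : (Y.subdivide n hinv hn).bdry f = (Y.subdivide n hinv hn).bdry g := by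
      show (Y.bdry f).flatMap _ = (Y.bdry g).flatMap _
      rw [h1]
    by_contra hfg
    refine hφ f g hfg (by rw [← φ.map_bdry, ← φ.map_bdry, h2]) ?_
    have h3 := (Y.subdivide n hinv hn).bdry_ne_nil g
    refine ⟨0, ((Y.subdivide n hinv hn).bdry g).head h3, ?_, ?_⟩
    · rw [h2, ← List.head?_eq_getElem?, List.head?_eq_some_head]
    · rw [← List.head?_eq_getElem?, List.head?_eq_some_head]
  refine ⟨fun t f => ⟨_, hmem t f⟩, ?_, ?_, ?_⟩
  · intro t f g h
    exact hinj t f g (congrArg Subtype.val h)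
  · intro t R hR
    refine ⟨labelingOfWords Y hinv hn R (wd t) (hwd t).1 (hwd t).2.1 ?_, ?_⟩
    · intro f
      by_cases hf : f ∈ A
      · exact Or.inl (hR f hf)
      · right
        rw [← flatMap_invRev (hwd t).2.1, ← Y.bdry_finv]
        exact hR _ ((hA f).2 hf)
    · intro f g hfg h
      exact absurd (hinj t f g h) hfg
  · intro t t' f h e he
    have h1 : wd t e = wd t' e := eq_of_flatMap_eq (fun e => by rw [(hwd t).1, (hwd t').1])
      (congrArg Subtype.val h) e he
    refine ⟨(hwd t).2.2.2.2.2 t' e h1, (hwd t).2.2.2.2.2 t' _ ?_⟩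
    rw [(hwd t).2.1, (hwd t').2.1, h1]

open Classical in
/-- The edges on the boundaries of a set of faces, in both orientations. -/
noncomputable def boundaryEdges [Fintype E] (Y : TwoComplex V E F) (J : Finset F) : Finset E :=
  Finset.univ.filter fun e => ∃ f ∈ J, e ∈ Y.bdry f ∨ Y.inv e ∈ Y.bdry f

/-- The number of functions that agree with a given one on a set of arguments. -/
theorem card_agree_mul_le [Fintype E] (ν : E → ℕ) (q : ℕ) (B : Finset E)
    (G : Finset (DigitChoice ν q)) (hG : ∀ t ∈ G, ∀ t' ∈ G, ∀ e ∈ B, t e = t' e) :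
    G.card * q ^ (∑ e ∈ B, ν e) ≤ Nat.card (DigitChoice ν q) := by
  classical
  have h1 : G.card ≤ Fintype.card ((e : {e // e ∈ Bᶜ}) → Fin (ν e) → Fin q) := by
    rw [← Finset.card_univ]
    refine Finset.card_le_card_of_injOn (fun t e => t e)
      (fun _ _ => Finset.mem_coe.2 (Finset.mem_univ _)) ?_
    intro t ht t' ht' h
    funext e
    by_cases he : e ∈ B
    · exact hG t ht t' ht' e he
    · exact congrFun h ⟨e, Finset.mem_compl.2 he⟩
  have h2 : Fintype.card ((e : {e // e ∈ Bᶜ}) → Fin (ν e) → Fin q) = q ^ ∑ e ∈ Bᶜ, ν e := by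
    rw [Fintype.card_pi, ← Finset.prod_pow_eq_pow_sum, 
      ← Finset.prod_coe_sort Bᶜ fun e => q ^ ν e]
    exact Finset.prod_congr rfl fun e _ => by simp
  have h3 : Nat.card (DigitChoice ν q) = q ^ ∑ e, ν e := by
    rw [Nat.card_eq_fintype_card, Fintype.card_pi, ← Finset.prod_pow_eq_pow_sum]
    simp
  rw [h3, ← Finset.sum_compl_add_sum B, pow_add, ← h2]
  exact Nat.mul_le_mul_right _ h1

/-- From g ≤ a q^(-s) and s ≥ xc - C one gets g y^c ≤ a q^C (y q^(-x))^c, where the exponent c ≥ 1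
can be dropped. -/
theorem mul_pow_le_of_mul_pow_le {g a y q x C : ℝ} {s c : ℕ} (hg : 0 ≤ g) (hy : 0 ≤ y)
    (hq : 1 ≤ q) (hgs : g * q ^ s ≤ a) (hx : x * c ≤ s + C) (hz : y * q ^ (-x) ≤ 1) (hc : c ≠ 0) :
    g * y ^ c ≤ q ^ C * (y * q ^ (-x)) * a := by
  have hq0 : 0 < q := by linarith
  have h5 : 1 ≤ q ^ s * (q ^ C * q ^ (-(x * c))) := by
    rw [← Real.rpow_natCast, ← Real.rpow_add hq0, ← Real.rpow_add hq0]
    exact Real.one_le_rpow hq (by linarith)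
  have h6 : (y * q ^ (-x)) ^ c = y ^ c * q ^ (-(x * c)) := by
    rw [mul_pow, ← Real.rpow_natCast (q ^ (-x)), ← Real.rpow_mul hq0.le, neg_mul]
  have h7 : (y * q ^ (-x)) ^ c ≤ y * q ^ (-x) := pow_le_of_le_one (by positivity) hz hc
  calc g * y ^ c ≤ g * y ^ c * (q ^ s * (q ^ C * q ^ (-(x * c)))) :=
        le_mul_of_one_le_right (by positivity) h5
    _ = q ^ C * (y * q ^ (-x)) ^ c * (g * q ^ s) := by rw [h6]; ring
    _ ≤ q ^ C * (y * q ^ (-x)) * a :=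
        mul_le_mul (mul_le_mul_of_nonneg_left h7 (by positivity)) hgs (by positivity)
          (by positivity)

/-- The proportion of the `r`-subsets of the ball by which a subdivision of `Y` is not fillable is
small if all sets of faces have many edges. -/
theorem ncard_not_fillable_le [Fintype E] [Fintype F] (Y : TwoComplex V E F) {n : E → ℕ}
    (hinv : ∀ e, n (Y.inv e) = n e) (hn : ∀ e, 0 < n e) (hm : 2 ≤ m) [Fintype (relBall m ℓ)]
    (hnE : ∀ e, 2 * (Fintype.card E + 1) + 1 ≤ n e)
    (hfill : Fillable (Y.subdivide n hinv hn) (relBall m ℓ))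
    (A : Finset F) (hA : ∀ f, Y.finv f ∈ A ↔ f ∉ A) (T : Set E) (hT : ∀ e, Y.inv e ∈ T ↔ e ∉ T)
    (x C : ℝ) (hx : ∀ J ⊆ A, J.Nonempty → x * J.card ≤
      ∑ e ∈ boundaryEdges Y J, (numFree T (Fintype.card E + 1) n e : ℝ) + C)
    {r : ℕ} (hr : r ≤ Fintype.card (relBall m ℓ)) (hAr : 2 * A.card ≤ r) (hr0 : 0 < r)
    (hz : (Fintype.card (relBall m ℓ) / r : ℝ) * ((2 * m - 1 : ℕ) : ℝ) ^ (-x) ≤ 1) :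
    (Set.ncard {S : Finset (relBall m ℓ) | S.card = r ∧
      ¬ Fillable (Y.subdivide n hinv hn) (relators (S : Set (relBall m ℓ)))} : ℝ) ≤
      4 ^ A.card * (Nat.card (Finset F × (F → F)) * (((2 * m - 1 : ℕ) : ℝ) ^ C *
        ((Fintype.card (relBall m ℓ) / r : ℝ) * ((2 * m - 1 : ℕ) : ℝ) ^ (-x)))) *
        (Fintype.card (relBall m ℓ)).choose r := by
  classical
  obtain ⟨lab, hlab_inj, hlab_fill, hlab_agree⟩ :=
    exists_label_family Y hinv hn hm hnE hfill A hA T hT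
  set y : ℝ := (Fintype.card (relBall m ℓ) / r : ℝ) with hy
  set q : ℝ := ((2 * m - 1 : ℕ) : ℝ) with hq
  let Θ := DigitChoice (numFree T (Fintype.card E + 1) n) (2 * m - 1)
  have hq1 : 1 ≤ q := by rw [hq]; exact_mod_cast (by omega)
  have hq0 : 0 < q := by linarith
  have hy0 : 0 ≤ y := by positivity
  have : Nonempty (Fin (2 * m - 1)) := ⟨⟨0, by omega⟩⟩
  let H : Θ → Finset (relBall m ℓ) := fun t => A.image (lab t)
  have hH : ∀ t, (H t).card = A.card := fun t => Finset.card_image_of_injective _ (hlab_inj t)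
  have hsub : {S : Finset (relBall m ℓ) | S.card = r ∧
      ¬ Fillable (Y.subdivide n hinv hn) (relators (S : Set (relBall m ℓ)))} ⊆
      {S | S.card = r ∧ ∀ t, ¬ H t ⊆ S} := by
    rintro S ⟨hS, hnot⟩
    refine ⟨hS, fun t ht => hnot (hlab_fill t _ fun f hf => ?_)⟩
    exact ⟨lab t f, ht (Finset.mem_image_of_mem _ hf), rfl⟩
  refine le_trans (Nat.cast_le.2 (Set.ncard_le_ncard hsub (Set.toFinite _)))
    (card_forall_not_subset_le H hH hr hAr hr0 fun t => ?_)
  -- The faces whose label under t' also occurs under t, possibly on another face; `π` chooses such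
  -- a face.
  let J : Θ → Finset F := fun t' => A.filter fun g => lab t' g ∈ H t
  have hπ : ∀ t' : Θ, ∃ π : F → F, ∀ g ∈ J t', lab t' g = lab t (π g) := by
    intro t'
    have h1 : ∀ g, ∃ f, g ∈ J t' → lab t' g = lab t f := by
      intro g
      by_cases hg : g ∈ J t'
      · obtain ⟨f, -, hf⟩ := Finset.mem_image.1 (Finset.mem_filter.1 hg).2
        exact ⟨f, fun _ => hf.symm⟩
      · exact ⟨g, fun h => absurd h hg⟩
    choose π hπ using h1
    exact ⟨π, hπ⟩
  choose π hπ using hπ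
  have hJ : ∀ t', H t ∩ H t' = (J t').image (lab t') := by
    intro t'
    ext w
    simp only [H, J, Finset.mem_inter, Finset.mem_image, Finset.mem_filter]
    constructor
    · rintro ⟨hw, g, hg, rfl⟩
      exact ⟨g, ⟨hg, hw⟩, rfl⟩
    · rintro ⟨g, ⟨hg, hw⟩, rfl⟩
      exact ⟨hw, g, hg, rfl⟩
  have hJcard : ∀ t', (H t ∩ H t').card = (J t').card := fun t' => by
    rw [hJ, Finset.card_image_of_injective _ (hlab_inj t')]
  have hJne : ∀ t', ¬ Disjoint (H t) (H t') → (J t').Nonempty := by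
    intro t' h
    rw [Finset.disjoint_iff_inter_eq_empty, hJ, Finset.image_eq_empty] at h
    exact Finset.nonempty_iff_ne_empty.2 h
  -- Fixing both J and π fixes the labels on J, hence all free letters on its boundary edges. There
  -- are boundedly many pairs (J, π), so it suffices to bound each fiber.
  have hfiber : ∀ τ : Finset F × (F → F),
      ∑ t' ∈ (Finset.univ.filter fun t' => ¬ Disjoint (H t) (H t')).filter
        (fun t' => (J t', π t') = τ), y ^ (H t ∩ H t').card ≤
        q ^ C * (y * q ^ (-x)) * Fintype.card Θ := by
    intro τ
    set G := (Finset.univ.filter fun t' => ¬ Disjoint (H t) (H t')).filter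
        (fun t' => (J t', π t') = τ) with hG
    rcases Finset.eq_empty_or_nonempty G with hGe | ⟨t₀, ht₀⟩
    · rw [hGe, Finset.sum_empty]
      positivity
    have hGmem : ∀ t' ∈ G, ¬ Disjoint (H t) (H t') ∧ J t' = τ.1 ∧ π t' = τ.2 := by
      intro t' ht'
      have h1 := Finset.mem_filter.1 ht'
      exact ⟨(Finset.mem_filter.1 h1.1).2, congrArg Prod.fst h1.2, congrArg Prod.snd h1.2⟩
    obtain ⟨hd, hJ₀, -⟩ := hGmem t₀ ht₀
    have hτne : τ.1.Nonempty := hJ₀ ▸ hJne t₀ hd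
    have hτA : τ.1 ⊆ A := hJ₀ ▸ Finset.filter_subset _ _
    have hGcard := card_agree_mul_le _ (2 * m - 1) (boundaryEdges Y τ.1) G (by
      intro t₁ h₁ t₂ h₂ e he
      obtain ⟨-, hJ₁, hπ₁⟩ := hGmem t₁ h₁
      obtain ⟨-, hJ₂, hπ₂⟩ := hGmem t₂ h₂
      obtain ⟨f, hf, hef⟩ := (Finset.mem_filter.1 he).2
      have h3 : lab t₁ f = lab t₂ f := by
        rw [hπ t₁ f (hJ₁ ▸ hf), hπ t₂ f (hJ₂ ▸ hf), hπ₁, hπ₂]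
      rcases hef with hef | hef
      · exact (hlab_agree t₁ t₂ f h3 e hef).1
      · have h4 := (hlab_agree t₁ t₂ f h3 _ hef).2
        rwa [Y.inv_inv] at h4)
    set s := ∑ e ∈ boundaryEdges Y τ.1, numFree T (Fintype.card E + 1) n e with hs
    have hGcard' : (G.card : ℝ) * q ^ s ≤ Fintype.card Θ := by
      rw [hq, ← Nat.card_eq_fintype_card]
      exact_mod_cast hGcard
    have hxs : x * τ.1.card ≤ (s : ℝ) + C := by
      rw [hs]
      push_cast
      exact hx τ.1 hτA hτne
    refine le_of_eq_of_le ?_ (mul_pow_le_of_mul_pow_le (Nat.cast_nonneg _) hy0 hq1 hGcard' hxs hz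
      (Finset.card_pos.2 hτne).ne')
    rw [← nsmul_eq_mul, ← Finset.sum_const]
    exact Finset.sum_congr rfl fun t' ht' => by rw [hJcard, (hGmem t' ht').2.1]
  rw [← Finset.sum_fiberwise_of_maps_to (s := Finset.univ.filter fun t' => ¬ Disjoint (H t) (H t'))
    (t := (Finset.univ : Finset (Finset F × (F → F)))) (g := fun t' => (J t', π t'))
    (fun _ _ => Finset.mem_univ _)]
  refine (Finset.sum_le_sum fun τ _ => hfiber τ).trans (le_of_eq ?_)
  rw [Finset.sum_const, Finset.card_univ, nsmul_eq_mul, Nat.card_eq_fintype_card]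
  ring

end Lower

/-! ### Lengths, densities and numbers of unit edges. -/

namespace GeometricForm

variable {V E F : Type*} (Y : GeometricForm V E F)

theorem dens_nonneg (Z : Y.toTwoComplex.Sub) : 0 ≤ Y.dens Z := by
  unfold dens
  have : 0 ≤ ∑ᶠ e ∈ Z.edges, Y.len e := finsum_nonneg fun e => finsum_nonneg fun _ => (Y.len_pos e).le
  positivity

theorem densC_nonneg : 0 ≤ Y.densC := by
  obtain ⟨Z, -, hZ⟩ := Y.exists_dens_eq_densC
  rw [← hZ]
  exact Y.dens_nonneg Z

open Classical in
/-- The sub-2-complex spanned by a set of faces. -/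
noncomputable def subOfFaces [Fintype E] (J : Finset F) : Y.toTwoComplex.Sub where
  verts := Set.univ
  edges := boundaryEdges Y.toTwoComplex J
  faces := (J ∪ J.image Y.finv : Finset F)
  src_mem := fun _ _ => Set.mem_univ _
  tgt_mem := fun _ _ => Set.mem_univ _
  inv_mem := by
    intro e he
    simp only [boundaryEdges, Finset.coe_filter, Finset.mem_univ, true_and, Set.mem_ofPred_eq,
      Y.inv_inv] at he ⊢
    obtain ⟨f, hf, h⟩ := he
    exact ⟨f, hf, h.symm⟩
  finv_mem := by
    intro f hf
    rw [Finset.mem_coe, Finset.mem_union] at hf ⊢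
    rcases hf with hf | hf
    · exact Or.inr (Finset.mem_image_of_mem _ hf)
    · obtain ⟨g, hg, rfl⟩ := Finset.mem_image.1 hf
      rw [Y.finv_finv]
      exact Or.inl hg
  bdry_mem := by
    intro f hf e he
    simp only [boundaryEdges, Finset.coe_filter, Finset.mem_univ, true_and, Set.mem_ofPred_eq]
    rw [Finset.mem_coe, Finset.mem_union] at hf
    rcases hf with hf | hf
    · exact ⟨f, hf, Or.inl he⟩
    · obtain ⟨g, hg, rfl⟩ := Finset.mem_image.1 hf
      rw [Y.bdry_finv, List.mem_reverse, List.mem_map] at he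
      obtain ⟨e', he', rfl⟩ := he
      exact ⟨g, hg, Or.inr (by rwa [Y.inv_inv])⟩

theorem dens_mul_ncard [Fintype E] (Z : Y.toTwoComplex.Sub) (B : Finset E) (hB : Z.edges = B)
    (hZ : Z.faces.Nonempty) : Y.dens Z * Z.faces.ncard = ∑ e ∈ B, Y.len e := by
  have := Y.finite_faces
  have h1 : (0 : ℝ) < Z.faces.ncard := by
    exact_mod_cast (Set.ncard_pos (Set.toFinite _)).2 hZ
  have h2 : ∑ᶠ e ∈ Z.edges, Y.len e = ∑ e ∈ B, Y.len e := by
    rw [hB]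
    exact finsum_mem_coe_finset _ _
  rw [dens, h2]
  field_simp

/-- The faces of J and their inverses span a sub-2-complex with 2|J| oriented faces, to which
minimality of the critical density applies. Edge lengths are likewise summed over both orientations.
-/
theorem densC_mul_le [Fintype E] (J : Finset F) (hJ : J.Nonempty)
    (hJinv : ∀ f ∈ J, Y.finv f ∉ J) :
    Y.densC * (2 * J.card) ≤ ∑ e ∈ boundaryEdges Y.toTwoComplex J, Y.len e := by
  classical
  have hne : (Y.subOfFaces J).faces.Nonempty := by
    obtain ⟨f, hf⟩ := hJ
    exact ⟨f, Finset.mem_coe.2 (Finset.mem_union_left _ hf)⟩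
  have hcard : (Y.subOfFaces J).faces.ncard = 2 * J.card := by
    show ((J ∪ J.image Y.finv : Finset F) : Set F).ncard = _
    rw [Set.ncard_coe_finset, Finset.card_union_of_disjoint, Finset.card_image_of_injective, two_mul]
    · exact Function.LeftInverse.injective Y.finv_finv
    · rw [Finset.disjoint_left]
      intro f hf h
      obtain ⟨g, hg, rfl⟩ := Finset.mem_image.1 h
      exact hJinv g hg hf
  rw [← Y.dens_mul_ncard (Y.subOfFaces J) _ rfl hne, hcard]
  push_cast
  exact mul_le_mul_of_nonneg_right (Y.densC_le _ hne) (by positivity)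

theorem sum_toFinset_le [DecidableEq E] (l : List E) :
    ∑ e ∈ l.toFinset, Y.len e ≤ (l.map Y.len).sum := by
  induction l with
  | nil => simp
  | cons a l ih =>
    rw [List.toFinset_cons, List.map_cons, List.sum_cons]
    by_cases h : a ∈ l.toFinset
    · rw [Finset.insert_eq_of_mem h]
      linarith [Y.len_pos a]
    · rw [Finset.sum_insert h]
      linarith

/-- A single face with its boundary already has density at most 1. In (ii) this makes the chosen d'
positive. -/
theorem densC_le_one : Y.densC ≤ 1 := by
  classical
  have := Y.finite_edges
  have := Fintype.ofFinite E
  obtain ⟨f⟩ := Y.nonempty_faces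
  have h1 := Y.densC_mul_le {f} (Finset.singleton_nonempty f) (by
    intro g hg
    rw [Finset.mem_singleton] at hg ⊢
    rw [hg]
    exact Y.toTwoComplex.finv_ne f)
  have h2 : boundaryEdges Y.toTwoComplex {f} ⊆
      (Y.bdry f).toFinset ∪ (Y.bdry f).toFinset.image Y.inv := by
    intro e he
    simp only [boundaryEdges, Finset.mem_filter, Finset.mem_univ, true_and,
      Finset.mem_singleton, exists_eq_left] at he
    rw [Finset.mem_union, List.mem_toFinset]
    refine he.imp_right fun h => Finset.mem_image.2 ⟨_, List.mem_toFinset.2 h, Y.inv_inv e⟩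
  have h3 : ∑ e ∈ boundaryEdges Y.toTwoComplex {f}, Y.len e ≤ 2 * 1 := by
    refine (Finset.sum_le_sum_of_subset_of_nonneg h2 fun e _ _ => (Y.len_pos e).le).trans ?_
    have h4 := Finset.sum_union_inter (s₁ := (Y.bdry f).toFinset)
      (s₂ := (Y.bdry f).toFinset.image Y.inv) (f := Y.len)
    have h5 : 0 ≤ ∑ e ∈ (Y.bdry f).toFinset ∩ (Y.bdry f).toFinset.image Y.inv, Y.len e :=
      Finset.sum_nonneg fun e _ => (Y.len_pos e).le
    have h6 : ∑ e ∈ (Y.bdry f).toFinset.image Y.inv, Y.len e = ∑ e ∈ (Y.bdry f).toFinset, Y.len e := by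
      rw [Finset.sum_image ((Function.LeftInverse.injective Y.inv_inv).injOn)]
      exact Finset.sum_congr rfl fun e _ => Y.len_inv e
    have h7 := (Y.sum_toFinset_le (Y.bdry f)).trans (Y.bdry_len_le f)
    linarith
  rw [Finset.card_singleton] at h1
  push_cast at h1
  linarith

theorem le_numEdges_add_one (ℓ : ℕ) (e : E) : Y.len e * ℓ ≤ Y.numEdges ℓ e + 1 := by
  have h1 := (Nat.lt_floor_add_one (Y.len e * ℓ)).le
  have h2 : (⌊Y.len e * ℓ⌋₊ : ℝ) ≤ Y.numEdges ℓ e := by exact_mod_cast le_max_right _ _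
  linarith

theorem numEdges_le {ℓ : ℕ} {e : E} (h : 1 ≤ Y.len e * ℓ) : (Y.numEdges ℓ e : ℝ) ≤ Y.len e * ℓ := by
  have h1 : 1 ≤ ⌊Y.len e * ℓ⌋₊ := Nat.le_floor (by exact_mod_cast h)
  rw [numEdges, max_eq_right h1]
  exact Nat.floor_le (by linarith)

theorem eventually_le_len_mul (K : ℝ) : ∀ᶠ ℓ : ℕ in atTop, ∀ e, K ≤ Y.len e * ℓ := by
  have := Y.finite_edges
  rw [Filter.eventually_all]
  intro e
  exact (tendsto_natCast_atTop_atTop.const_mul_atTop (Y.len_pos e)).eventually_ge_atTop K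

/-- The number of edges of a subdivided sub-2-complex. -/
theorem ncard_subdivided_edges_le [Fintype E] {ℓ : ℕ} (hℓ : ∀ e, 1 ≤ Y.len e * ℓ)
    (Z : Y.toTwoComplex.Sub) (hZ : Z.faces.Nonempty) :
    {p : TwoComplex.SubdivEdge (Y.numEdges ℓ) | p.1.1 ∈ Z.edges}.Finite ∧
    ({p : TwoComplex.SubdivEdge (Y.numEdges ℓ) | p.1.1 ∈ Z.edges}.ncard : ℝ) ≤
      ℓ * Y.dens Z * Z.faces.ncard := by
  classical
  let B : Finset E := Z.edges.toFinset
  let G : Finset (Σ _ : E, ℕ) := B.sigma fun e => Finset.range (Y.numEdges ℓ e)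
  let Φ : TwoComplex.SubdivEdge (Y.numEdges ℓ) → Σ _ : E, ℕ := fun p => ⟨p.1.1, p.1.2⟩
  have hmaps : ∀ p ∈ {p : TwoComplex.SubdivEdge (Y.numEdges ℓ) | p.1.1 ∈ Z.edges},
      Φ p ∈ (G : Set (Σ _ : E, ℕ)) := by
    intro p hp
    exact Finset.mem_coe.2 (Finset.mem_sigma.2 ⟨Set.mem_toFinset.2 hp, Finset.mem_range.2 p.2⟩)
  have hinj : Function.Injective Φ := by
    intro p p' h
    have h1 := congrArg Sigma.fst h
    have h2 : p.1.2 = p'.1.2 := congrArg (fun x : Σ _ : E, ℕ => x.2) h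
    exact Subtype.ext (Prod.ext h1 h2)
  refine ⟨Set.Finite.of_injOn hmaps hinj.injOn G.finite_toSet, ?_⟩
  have h1 := Set.ncard_le_ncard_of_injOn Φ hmaps hinj.injOn G.finite_toSet
  rw [Set.ncard_coe_finset, Finset.card_sigma] at h1
  simp only [Finset.card_range] at h1
  rw [mul_assoc, Y.dens_mul_ncard Z B (Set.coe_toFinset _).symm hZ, Finset.mul_sum]
  calc _ ≤ ((∑ e ∈ B, Y.numEdges ℓ e : ℕ) : ℝ) := by exact_mod_cast h1
    _ ≤ _ := by
      push_cast
      exact Finset.sum_le_sum fun e _ => (Y.numEdges_le (hℓ e)).trans (mul_comm _ _).le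

/-- Every set of faces of a subdivided geometric form has many free letters. -/
theorem densC_mul_card_le_sum_numFree [Fintype E] (ℓ : ℕ) (T : Set E)
    (hT : ∀ e, Y.inv e ∈ T ↔ e ∉ T) (K : ℕ) (J : Finset F) (hJ : J.Nonempty)
    (hJinv : ∀ f ∈ J, Y.finv f ∉ J) :
    ℓ * Y.densC * J.card ≤ ∑ e ∈ boundaryEdges Y.toTwoComplex J,
      (numFree T K (Y.numEdges ℓ) e : ℝ) + Fintype.card E * (2 * K + 2) := by
  classical
  set B := boundaryEdges Y.toTwoComplex J with hB
  have hBinv : ∀ e ∈ B, Y.inv e ∈ B := fun e he => (Y.subOfFaces J).inv_mem e he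
  have h1 := Y.densC_mul_le J hJ hJinv
  -- Inversion exchanges the two halves of `B`, so half of the total length lies on `T`, where the
  -- free letters are.
  have h2 : ∑ e ∈ B.filter (· ∉ T), Y.len e = ∑ e ∈ B.filter (· ∈ T), Y.len e := by
    refine Finset.sum_nbij' Y.inv Y.inv ?_ ?_ (fun e _ => Y.inv_inv e) (fun e _ => Y.inv_inv e)
      (fun e _ => (Y.len_inv e).symm)
    · intro e he
      rw [Finset.mem_filter] at he ⊢
      exact ⟨hBinv e he.1, (hT e).2 he.2⟩
    · intro e he
      rw [Finset.mem_filter] at he ⊢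
      exact ⟨hBinv e he.1, fun h => (hT e).1 h he.2⟩
  rw [← hB, ← Finset.sum_filter_add_sum_filter_not B (· ∈ T), h2] at h1
  -- Each edge loses at most 2K + 2 letters: one by rounding down and 2K + 1 fixed ones.
  have h3 : ∑ e ∈ B.filter (· ∈ T), (Y.len e * ℓ - (2 * K + 2)) ≤
      ∑ e ∈ B, (numFree T K (Y.numEdges ℓ) e : ℝ) := by
    rw [Finset.sum_filter]
    refine Finset.sum_le_sum fun e _ => ?_
    by_cases he : e ∈ T
    · rw [if_pos he, numFree, if_pos he]
      have h4 := Y.le_numEdges_add_one ℓ e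
      have h5 : (Y.numEdges ℓ e : ℝ) ≤ (Y.numEdges ℓ e - (2 * K + 1) : ℕ) + (2 * K + 1) := by
        exact_mod_cast (by omega)
      linarith
    · rw [if_neg he]
      positivity
  rw [Finset.sum_sub_distrib, ← Finset.sum_mul, Finset.sum_const, nsmul_eq_mul] at h3
  have h6 : ((B.filter (· ∈ T)).card : ℝ) * (2 * K + 2) ≤ Fintype.card E * (2 * K + 2) := by
    refine mul_le_mul_of_nonneg_right ?_ (by positivity)
    exact_mod_cast Finset.card_le_univ _
  have h7 : Y.densC * J.card ≤ ∑ e ∈ B.filter (· ∈ T), Y.len e := by linarith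
  have h8 := mul_le_mul_of_nonneg_left h7 (Nat.cast_nonneg (α := ℝ) ℓ)
  linarith

end GeometricForm

/-! ### From densities to cardinalities and limits in probability. -/

section Density

variable {α : Type*} [Finite α]

theorem ncard_le_of_setDens_lt {S : Set α} {d : ℝ} (hα : 1 < Nat.card α)
    (h : setDens S < (d : EReal)) : (S.ncard : ℝ) ≤ (Nat.card α : ℝ) ^ d := by
  unfold setDens at h
  split_ifs at h with hS
  · rw [hS, Set.ncard_empty, Nat.cast_zero]
    positivity
  · have h1 : (0 : ℝ) < S.ncard := by
      exact_mod_cast (Set.ncard_pos (Set.toFinite _)).2 (Set.nonempty_iff_ne_empty.2 hS)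
    exact ((Real.logb_lt_iff_lt_rpow (by exact_mod_cast hα) h1).1 (EReal.coe_lt_coe_iff.1 h)).le

theorem le_ncard_of_lt_setDens {S : Set α} {d : ℝ} (hα : 1 < Nat.card α)
    (h : (d : EReal) < setDens S) : (Nat.card α : ℝ) ^ d ≤ S.ncard := by
  unfold setDens at h
  split_ifs at h with hS
  · exact absurd h (by simp)
  · have h1 : (0 : ℝ) < S.ncard := by
      exact_mod_cast (Set.ncard_pos (Set.toFinite _)).2 (Set.nonempty_iff_ne_empty.2 hS)
    exact ((Real.lt_logb_iff_rpow_lt (by exact_mod_cast hα) h1).1 (EReal.coe_lt_coe_iff.1 h)).le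

end Density

/-- An event holds asymptotically almost surely if its failure together with an asymptotically
almost sure event has a probability tending to zero. -/
theorem asymptoticallyAlmostSurely_of_le {Ω : ℕ → Type*} [∀ ℓ, MeasurableSpace (Ω ℓ)]
    (P : ∀ ℓ, Measure (Ω ℓ)) [∀ ℓ, IsProbabilityMeasure (P ℓ)] (U Q : ∀ ℓ, Ω ℓ → Prop)
    (hU : AsymptoticallyAlmostSurely P U) (ε : ℕ → ℝ) (hε : Tendsto ε atTop (𝓝 0))
    (h : ∀ᶠ ℓ in atTop, (P ℓ).real {ω | U ℓ ω ∧ ¬ Q ℓ ω} ≤ ε ℓ) :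
    AsymptoticallyAlmostSurely P Q := by
  unfold AsymptoticallyAlmostSurely at *
  have h1 : Tendsto (fun ℓ => P ℓ {ω | U ℓ ω} - ENNReal.ofReal (ε ℓ)) atTop (𝓝 (1 - 0)) := by
    refine ENNReal.Tendsto.sub hU ?_ (Or.inl ENNReal.one_ne_top)
    simpa using ENNReal.tendsto_ofReal hε
  rw [tsub_zero] at h1
  refine tendsto_of_tendsto_of_tendsto_of_le_of_le' h1 tendsto_const_nhds ?_
    (Eventually.of_forall fun ℓ => prob_le_one)
  filter_upwards [h] with ℓ hℓ
  rw [tsub_le_iff_right]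
  -- Subadditivity replaces complements, so measurability of the events is not needed.
  have h2 : {ω | U ℓ ω} ⊆ {ω | Q ℓ ω} ∪ {ω | U ℓ ω ∧ ¬ Q ℓ ω} := by
    intro ω hω
    by_cases hQ : Q ℓ ω
    · exact Or.inl hQ
    · exact Or.inr ⟨hω, hQ⟩
  refine (measure_mono h2).trans ((measure_union_le _ _).trans ?_)
  gcongr
  rw [← ofReal_measureReal]
  exact ENNReal.ofReal_le_ofReal hℓ

/-! ### Growth of the ball and the limits of the two bounds. -/

section Asymptotics

theorem tendsto_card_relBall {m : ℕ} (hm : 2 ≤ m) :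
    Tendsto (fun ℓ => (Nat.card (relBall m ℓ) : ℝ)) atTop atTop := by
  have h1 : Tendsto (fun k : ℕ => ((2 * m - 1 : ℕ) : ℝ) ^ k) atTop atTop :=
    tendsto_pow_atTop_atTop_of_one_lt (by exact_mod_cast (by omega))
  have h2 : Tendsto (fun k : ℕ => (Nat.card (relBall m (k + 2)) : ℝ)) atTop atTop :=
    tendsto_atTop_mono (fun k => by exact_mod_cast pow_le_card_relBall hm k) h1
  exact (tendsto_add_atTop_iff_nat 2).1 h2

/-- With ℓ = k + 2 and |B_ℓ| ≥ q^k, the expression is at most a constant times the k-th power of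
q^(δ + d - 1) < 1. The lower bound on |B_ℓ| is the relevant one because d - 1 is negative. -/
theorem tendsto_upper_bound {m : ℕ} (hm : 2 ≤ m) {δ d : ℝ} (hδ : 0 ≤ δ) (hd : d < 1 - δ) :
    Tendsto (fun ℓ : ℕ => (2 * m + 1) * ((2 * m - 1 : ℕ) : ℝ) ^ (ℓ * δ) *
      (Nat.card (relBall m ℓ) : ℝ) ^ (d - 1)) atTop (𝓝 0) := by
  have hq : (1 : ℝ) < ((2 * m - 1 : ℕ) : ℝ) := by exact_mod_cast (by omega)
  set q : ℝ := ((2 * m - 1 : ℕ) : ℝ) with hqdef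
  have hq0 : 0 < q := by linarith
  refine (tendsto_add_atTop_iff_nat 2).1 ?_
  have h1 : Tendsto (fun k : ℕ => (2 * m + 1) * q ^ (2 * δ) * (q ^ (δ + (d - 1))) ^ k) atTop
      (𝓝 ((2 * m + 1) * q ^ (2 * δ) * 0)) :=
    (tendsto_pow_atTop_nhds_zero_of_lt_one (by positivity)
      (Real.rpow_lt_one_of_one_lt_of_neg hq (by linarith))).const_mul _
  rw [mul_zero] at h1
  refine squeeze_zero (fun k => by positivity) (fun k => ?_) h1
  have h2 : (Nat.card (relBall m (k + 2)) : ℝ) ^ (d - 1) ≤ (q ^ k) ^ (d - 1) :=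
    Real.rpow_le_rpow_of_nonpos (by positivity)
      (by rw [hqdef]; exact_mod_cast pow_le_card_relBall hm k) (by linarith)
  calc _ ≤ (2 * m + 1) * q ^ (((k + 2 : ℕ) : ℝ) * δ) * (q ^ k) ^ (d - 1) :=
        mul_le_mul_of_nonneg_left h2 (by positivity)
    _ = _ := by
      rw [← Real.rpow_natCast, ← Real.rpow_natCast, ← Real.rpow_mul hq0.le, ← Real.rpow_mul hq0.le,
        mul_assoc, mul_assoc, ← Real.rpow_add hq0, ← Real.rpow_add hq0]
      congr 2
      push_cast
      ring

/-- Here |B_ℓ| ≤ (ℓ+1)(2m+1) q^ℓ is used, and the linear factor is absorbed by the powers of q^(1 -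
d - δ) < 1. -/
theorem tendsto_lower_bound {m : ℕ} (hm : 2 ≤ m) {δ d : ℝ} (hd : 1 - δ < d) (hd0 : 0 ≤ d)
    (hd1 : d ≤ 1) :
    Tendsto (fun ℓ : ℕ => (Nat.card (relBall m ℓ) : ℝ) ^ (1 - d) *
      ((2 * m - 1 : ℕ) : ℝ) ^ (-(ℓ * δ))) atTop (𝓝 0) := by
  have hq : (1 : ℝ) < ((2 * m - 1 : ℕ) : ℝ) := by exact_mod_cast (by omega)
  have hcard : ∀ ℓ, (Nat.card (relBall m ℓ) : ℝ) ≤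
      (ℓ + 1) * (2 * m + 1) * ((2 * m - 1 : ℕ) : ℝ) ^ ℓ := by
    intro ℓ
    rw [mul_assoc]
    exact_mod_cast card_relBall_le (by omega) ℓ
  set q : ℝ := ((2 * m - 1 : ℕ) : ℝ) with hqdef
  have hq0 : 0 < q := by linarith
  set b : ℝ := q ^ (1 - d - δ) with hb
  have hb1 : b < 1 := Real.rpow_lt_one_of_one_lt_of_neg hq (by linarith)
  have hb0 : 0 ≤ b := by positivity
  have h1 : Tendsto (fun ℓ : ℕ => (2 * m + 1) * ((ℓ : ℝ) * b ^ ℓ + b ^ ℓ)) atTop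
      (𝓝 ((2 * m + 1) * (0 + 0))) :=
    ((tendsto_self_mul_const_pow_of_lt_one hb0 hb1).add
      (tendsto_pow_atTop_nhds_zero_of_lt_one hb0 hb1)).const_mul _
  rw [add_zero, mul_zero] at h1
  refine squeeze_zero (fun k => by positivity) (fun ℓ => ?_) h1
  have h2 : (1 : ℝ) ≤ (ℓ + 1) * (2 * m + 1) := by
    have : (0 : ℝ) ≤ ℓ := Nat.cast_nonneg _
    have : (0 : ℝ) ≤ m := Nat.cast_nonneg _
    nlinarith
  calc _ ≤ ((ℓ + 1) * (2 * m + 1) * q ^ ℓ) ^ (1 - d) * q ^ (-(ℓ * δ)) :=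
        mul_le_mul_of_nonneg_right
          (Real.rpow_le_rpow (Nat.cast_nonneg _) (hcard ℓ) (by linarith)) (by positivity)
    _ = ((ℓ + 1) * (2 * m + 1)) ^ (1 - d) * b ^ ℓ := by
      rw [Real.mul_rpow (by positivity) (by positivity), mul_assoc, hb, ← Real.rpow_natCast q,
        ← Real.rpow_natCast (q ^ _), ← Real.rpow_mul hq0.le, ← Real.rpow_mul hq0.le,
        ← Real.rpow_add hq0]
      congr 2
      ring
    _ ≤ ((ℓ + 1) * (2 * m + 1)) * b ^ ℓ := by
      refine mul_le_mul_of_nonneg_right ?_ (by positivity)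
      calc _ ≤ (((ℓ : ℝ) + 1) * (2 * m + 1)) ^ (1 : ℝ) :=
            Real.rpow_le_rpow_of_exponent_le h2 (by linarith)
        _ = _ := Real.rpow_one _
    _ = _ := by ring

end Asymptotics

/-! ### The two parts of the theorem. -/

section Main

variable {m : ℕ} {d : EReal} {Ω : ℕ → Type*} [∀ ℓ, MeasurableSpace (Ω ℓ)]
  {P : ∀ ℓ, Measure (Ω ℓ)} [∀ ℓ, IsProbabilityMeasure (P ℓ)]
  {R : ∀ ℓ, Ω ℓ → Set (relBall m ℓ)} {V E F : Type*}

/-- If the density is less than `1 - densC`, the geometric form is a.a.s. not fillable. -/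
theorem not_fillable_of_lt (hm : 2 ≤ m) (hR : IsRandomGroupSeq P R d) (Y : GeometricForm V E F)
    (hd : d < ((1 - Y.densC : ℝ) : EReal)) :
    AsymptoticallyAlmostSurely P
      (fun ℓ ω => ¬ Fillable (Y.complex ℓ) (relators (R ℓ ω))) := by
  classical
  have := Y.finite_edges
  have := Y.finite_faces
  have := Fintype.ofFinite E
  have := Fintype.ofFinite F
  -- The intermediate real d' keeps a gap to 1 - δ, as needed for exponential decay, and also covers
  -- d = -∞.
  obtain ⟨d', hdd', hd'⟩ := EReal.lt_iff_exists_real_btwn.1 hd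
  have hd' : d' < 1 - Y.densC := EReal.coe_lt_coe_iff.1 hd'
  obtain ⟨Z, hZ, hZd⟩ := Y.exists_dens_eq_densC
  have hlim := tendsto_upper_bound hm Y.densC_nonneg hd'
  set z : ℕ → ℝ := fun ℓ => (2 * m + 1) * ((2 * m - 1 : ℕ) : ℝ) ^ (ℓ * Y.densC) *
      (Nat.card (relBall m ℓ) : ℝ) ^ (d' - 1) with hz
  set N : ℝ :=
    (Nat.card (Finset F × (F → Fin (Fintype.card F * (Fintype.card F + 1)))) : ℝ) with hN
  refine asymptoticallyAlmostSurely_of_le P (fun ℓ ω => setDens (R ℓ ω) ∈ Set.Iio (d' : EReal)) _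
    (hR.densable _ (Iio_mem_nhds hdd')) (fun ℓ => N * z ℓ) (by simpa using hlim.const_mul N) ?_
  filter_upwards [hlim.eventually_le_const one_pos, Y.eventually_le_len_mul 1,
    (tendsto_card_relBall hm).eventually_gt_atTop 1] with ℓ hz1 hlen hn
  have := (relBall_finite m ℓ).fintype
  have hcard : Nat.card (relBall m ℓ) = Fintype.card (relBall m ℓ) := Nat.card_eq_fintype_card
  have hn' : 1 < Nat.card (relBall m ℓ) := by exact_mod_cast hn
  have hbound := measure_le_of_exchangeable (P ℓ) (R ℓ) (hR.measurable ℓ) (hR.perm_invariant ℓ)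
    (fun r => r ≤ Fintype.card (relBall m ℓ) ∧ (r : ℝ) ≤ (Nat.card (relBall m ℓ) : ℝ) ^ d')
    (fun S => Fillable (Y.complex ℓ) (relators S)) (N * z ℓ) (by positivity) (by
      rintro r ⟨hr, hrd⟩
      obtain ⟨hDfin, hD⟩ := Y.ncard_subdivided_edges_le hlen Z hZ
      rw [hZd] at hD
      have hrz : (2 * m + 1) * ((2 * m - 1 : ℕ) : ℝ) ^ (ℓ * Y.densC) *
          (r / Fintype.card (relBall m ℓ)) ≤ z ℓ := by
        refine mul_le_mul_of_nonneg_left ?_ (by positivity)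
        rw [← hcard, Real.rpow_sub_one (by positivity)]
        gcongr
      have hfaces : (Z.faces.toFinset.card : ℝ) = Z.faces.ncard := by
        rw [Set.ncard_eq_toFinset_card']
      refine (ncard_fillable_le (Y.complex ℓ) hm Z.faces.toFinset (by simpa using hZ) ?_ _ hDfin ?_
        ?_ (ℓ * Y.densC) (mul_nonneg (Nat.cast_nonneg _) Y.densC_nonneg) (by rwa [hfaces]) hr
        (hrz.trans hz1)).trans ?_
      · intro f hf
        rw [Set.mem_toFinset] at hf ⊢
        exact Z.finv_mem f hf
      · intro p hp
        exact Z.inv_mem _ hp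
      · intro f hf p hp
        rw [Set.mem_toFinset] at hf
        obtain ⟨e, he, hpe⟩ := List.mem_flatMap.1 hp
        obtain ⟨i, -, rfl⟩ := List.mem_map.1 hpe
        exact Z.bdry_mem f hf e he
      · exact mul_le_mul_of_nonneg_right (mul_le_mul_of_nonneg_left hrz (by positivity))
          (Nat.cast_nonneg _))
  refine le_trans (measureReal_mono ?_) hbound
  rintro ω ⟨hω, hfill⟩
  refine ⟨⟨?_, ncard_le_of_setDens_lt hn' hω⟩, not_not.1 hfill⟩
  rw [← hcard]
  exact Set.ncard_le_card _

/-- If the density is greater than `1 - densC`, the geometric form is a.a.s. fillable, provided it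
is fillable by all cyclically reduced words. -/
theorem fillable_of_gt (hm : 2 ≤ m) (hR : IsRandomGroupSeq P R d) (Y : GeometricForm V E F)
    (hd : ((1 - Y.densC : ℝ) : EReal) < d)
    (hfill : ∀ᶠ ℓ in atTop, Fillable (Y.complex ℓ) (relBall m ℓ)) :
    AsymptoticallyAlmostSurely P
      (fun ℓ ω => Fillable (Y.complex ℓ) (relators (R ℓ ω))) := by
  classical
  have := Y.finite_edges
  have := Y.finite_faces
  have := Fintype.ofFinite E
  have := Fintype.ofFinite F
  obtain ⟨d', hd', hdd'⟩ := EReal.lt_iff_exists_real_btwn.1 hd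
  have hd' : 1 - Y.densC < d' := EReal.coe_lt_coe_iff.1 hd'
  have hd0 : 0 < d' := by linarith [Y.densC_le_one]
  have hd1 : d' ≤ 1 := by
    have h1 : d ≤ 1 := by
      rcases hR.density_mem with h | h
      · rw [h]; exact bot_le
      · exact h.2
    exact_mod_cast (hdd'.trans_le h1).le
  obtain ⟨T, hT⟩ := exists_transversal Y.inv Y.inv_inv Y.inv_ne
  obtain ⟨A', hA'⟩ := exists_transversal Y.finv Y.finv_finv Y.toTwoComplex.finv_ne
  set A : Finset F := A'.toFinset with hAdef
  have hA : ∀ f, Y.finv f ∈ A ↔ f ∉ A := by simpa [hAdef] using hA'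
  have hlim := tendsto_lower_bound hm hd' hd0.le hd1
  set z : ℕ → ℝ := fun ℓ => (Nat.card (relBall m ℓ) : ℝ) ^ (1 - d') *
      ((2 * m - 1 : ℕ) : ℝ) ^ (-(ℓ * Y.densC)) with hz
  set K := Fintype.card E + 1 with hK
  set C : ℝ := Fintype.card E * (2 * K + 2) with hC
  set N : ℝ := 4 ^ A.card * (Nat.card (Finset F × (F → F)) * ((2 * m - 1 : ℕ) : ℝ) ^ C) with hN
  refine asymptoticallyAlmostSurely_of_le P (fun ℓ ω => setDens (R ℓ ω) ∈ Set.Ioi (d' : EReal)) _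
    (hR.densable _ (Ioi_mem_nhds hdd')) (fun ℓ => N * z ℓ) (by simpa using hlim.const_mul N) ?_
  -- As d' > 0, the number of relators eventually exceeds 2|A|, as the second moment bound requires.
  have hlarge := ((tendsto_rpow_atTop hd0).comp (tendsto_card_relBall hm)).eventually_ge_atTop
    (2 * A.card + 1 : ℝ)
  filter_upwards [hlim.eventually_le_const one_pos, Y.eventually_le_len_mul (2 * K + 2),
    (tendsto_card_relBall hm).eventually_gt_atTop 1, hlarge, hfill] with ℓ hz1 hlen hn hlarge hfill
  have := (relBall_finite m ℓ).fintype
  have hcard : Nat.card (relBall m ℓ) = Fintype.card (relBall m ℓ) := Nat.card_eq_fintype_card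
  have hn' : 1 < Nat.card (relBall m ℓ) := by exact_mod_cast hn
  have hbound := measure_le_of_exchangeable (P ℓ) (R ℓ) (hR.measurable ℓ) (hR.perm_invariant ℓ)
    (fun r => r ≤ Fintype.card (relBall m ℓ) ∧ (Nat.card (relBall m ℓ) : ℝ) ^ d' ≤ r)
    (fun S => ¬ Fillable (Y.complex ℓ) (relators S)) (N * z ℓ) (by positivity) (by
      rintro r ⟨hr, hrd⟩
      have hr2 : 2 * A.card + 1 ≤ r := by exact_mod_cast (hlarge.trans hrd : (_ : ℝ) ≤ _)
      have hr0 : 0 < r := by omega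
      have hrz : (Fintype.card (relBall m ℓ) / r : ℝ) * ((2 * m - 1 : ℕ) : ℝ) ^ (-(ℓ * Y.densC)) ≤
          z ℓ := by
        refine mul_le_mul_of_nonneg_right ?_ (by positivity)
        rw [← hcard, Real.rpow_sub (by positivity), Real.rpow_one]
        gcongr
      refine (ncard_not_fillable_le Y.toTwoComplex _ _ hm ?_ hfill A hA T hT (ℓ * Y.densC) C ?_ hr
        (by omega) hr0 (hrz.trans hz1)).trans ?_
      · intro e
        have h1 := (hlen e).trans (Y.le_numEdges_add_one ℓ e)
        have h2 : 2 * K + 2 ≤ Y.numEdges ℓ e + 1 := by exact_mod_cast h1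
        omega
      · intro J hJA hJ
        exact Y.densC_mul_card_le_sum_numFree ℓ T hT K J hJ fun f hf h =>
          (hA f).1 (hJA h) (hJA hf)
      · refine mul_le_mul_of_nonneg_right ?_ (Nat.cast_nonneg _)
        rw [hN, mul_assoc, mul_assoc]
        gcongr)
  refine le_trans (measureReal_mono ?_) hbound
  rintro ω ⟨hω, hfill⟩
  refine ⟨⟨?_, le_ncard_of_lt_setDens hn' hω⟩, hfill⟩
  rw [← hcard]
  exact Set.ncard_le_card _

end Main

theorem mainTheorem1 (m : ℕ) (hm : 2 ≤ m) (d : EReal)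
    {Ω : ℕ → Type*} [∀ ℓ, MeasurableSpace (Ω ℓ)]
    (P : ∀ ℓ, Measure (Ω ℓ)) [∀ ℓ, IsProbabilityMeasure (P ℓ)]
    (R : ∀ ℓ, Ω ℓ → Set (relBall m ℓ)) (hR : IsRandomGroupSeq P R d)
    {V E F : Type*} (Y : GeometricForm V E F) :
    (d < ((1 - Y.densC : ℝ) : EReal) →
      AsymptoticallyAlmostSurely P
        (fun ℓ ω => ¬ Fillable (Y.complex ℓ) (relators (R ℓ ω)))) ∧
    (((1 - Y.densC : ℝ) : EReal) < d →
      (∀ᶠ ℓ in atTop, Fillable (Y.complex ℓ) (relBall m ℓ)) →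
      AsymptoticallyAlmostSurely P
        (fun ℓ ω => Fillable (Y.complex ℓ) (relators (R ℓ ω)))) := by
  exact ⟨not_fillable_of_lt hm hR Y, fillable_of_gt hm hR Y⟩
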